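/- Let $N,n\in\mathbb N$ with $2\le n\le N$ and let $Z=(z_{j,r})\in\mathbb C^{N\times n}$. For a finite set $A$ and $k\in\mathbb N$ write $A^k_{\ne}$ for the set of $k$-tuples of pairwise distinct elements of $A$, and $[m]=\{1,\dots,m\}$. Put $$\mathrm{Per}(Z)=\sum_{j\in[N]^n_{\ne}}\prod_{r=1}^n z_{j_r,r},\qquad \widetilde z_r=\frac1N\sum_{j=1}^N z_{j,r},\qquad y_{u,v,r}=z_{u,r}-z_{v,r},\qquad \beta=\frac1n\sum_{r=1}^n|\widetilde z_r|^2,$$ $$\widetilde p^{(2)}=\sum_{R\subseteq[n],\,|R|=2}\Big(\prod_{r\in[n]\setminus R}\widetilde z_r\Big)\sum_{j=1}^N\prod_{r\in R}(z_{j,r}-\widetilde z_r).$$ Let $$\vartheta_3=\frac{(N-3)!}{N!}\sqrt{\frac{(n-3)!}{n!}}\Big(\sum_{(r,s,t)\in[n]^3_{\ne}}\Big(\sum_{(u,v,w)\in[N]^3_{\ne}}|y_{u,v,r}\,y_{u,v,s}\,y_{u,w,t}|\Big)^2\Big)^{1/2}\quad\text{if } n\ge3,$$ $$\vartheta_4=\frac{(N-4)!}{N!}\sqrt{\frac{(n-4)!}{n!}}\Big(\sum_{(q,r,s,t)\in[n]^4_{\ne}}\Big(\sum_{(u,v,w,x)\in[N]^4_{\ne}}|y_{u,v,q}\,y_{u,v,r}\,y_{w,x,s}\,y_{w,x,t}|\Big)^2\Big)^{1/2}\quad\text{if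 } n\ge4,$$ with $\vartheta_3=0$ if $n=2$ and $\vartheta_4=0$ if $n\in\{2,3\}$. For $\nu\in\{3,4\}$ let $$\kappa^{(\nu)}=\frac{1}{(n-\nu)(N-\nu)}\max_{J\subseteq[N],\,R\subseteq[n],\,|J|=|R|=\nu}\ \sum_{j\in[N]\setminus J}\ \sum_{r\in[n]\setminus R}|z_{j,r}|^2\quad\text{if } n\ge\nu+1,\qquad \kappa^{(\nu)}=1\quad\text{if } n\le\nu,$$ and for $x_1,x_2\in\mathbb R$ let (with $0^0=1$, empty sums being $0$) $$f_n(x_1,x_2)=\sum_{k=3}^n(n+k-2)(n-k+1)\,x_1^{n-k}x_2^{k-3},\qquad g_n(x_1,x_2)=\sum_{k=4}^n(k-3)(n+k-2)(n-k+1)\,x_1^{n-k}x_2^{k-4}.$$ Then $$\Big|\frac{(N-n)!}{N!}\mathrm{Per}(Z)-\prod_{r=1}^n\widetilde z_r+\frac{\widetilde p^{(2)}}{N(N-1)}\Big|\le\frac{\vartheta_3}{2N^2}\,f_n\big(\sqrt\beta,\sqrt{\kappa^{(3)}}\big)+\frac{\vartheta_4}{8N^2}\,g_n\big(\sqrt\beta,\sqrt{\kappa^{(4)}}\big).$$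 -/

import Mathlib

namespace PermApprox

open Finset

/-- Permanent of a rectangular matrix with `N` rows and `n` columns: the sum over all injective maps
`j` from the columns to the rows of the products of the entries `Z (j r) r`. -/
noncomputable def rectPermanent {N n : ℕ} (Z : Matrix (Fin N) (Fin n) ℂ) : ℂ :=
  ∑ j : Fin n ↪ Fin N, ∏ r, Z (j r) r

/-- Arithmetic mean of the entries of column `r`. -/
noncomputable def colMean {N n : ℕ} (Z : Matrix (Fin N) (Fin n) ℂ) (r : Fin n) : ℂ :=
  (1 / (N : ℂ)) * ∑ j, Z j r

/-- The second order correction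
`∑_{|R| = 2} (∏_{r ∉ R} z̃ r) * ∑_j ∏_{r ∈ R} (z j r - z̃ r)`. -/
noncomputable def secondOrderTerm {N n : ℕ} (Z : Matrix (Fin N) (Fin n) ℂ) : ℂ :=
  ∑ R ∈ (univ : Finset (Fin n)).powersetCard 2,
    (∏ r ∈ Rᶜ, colMean Z r) * ∑ j, ∏ r ∈ R, (Z j r - colMean Z r)

/-- Difference of the entries in rows `u` and `v` of column `r`. -/
def rowDiff {N n : ℕ} (Z : Matrix (Fin N) (Fin n) ℂ) (u v : Fin N) (r : Fin n) : ℂ :=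
  Z u r - Z v r

/-- Mean of the squared moduli of the column means. -/
noncomputable def beta {N n : ℕ} (Z : Matrix (Fin N) (Fin n) ℂ) : ℝ :=
  (1 / (n : ℝ)) * ∑ r, ‖colMean Z r‖ ^ 2

/-- Embeddings `c : Fin 3 ↪ Fin n` and `u : Fin 3 ↪ Fin N` are the triples `(r, s, t)` of distinct
columns and `(u, v, w)` of distinct rows. -/
noncomputable def theta3 {N n : ℕ} (Z : Matrix (Fin N) (Fin n) ℂ) : ℝ :=
  if 3 ≤ n then
    ((N - 3).factorial / N.factorial : ℝ) * √((n - 3).factorial / n.factorial : ℝ) *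
      √(∑ c : Fin 3 ↪ Fin n,
        (∑ u : Fin 3 ↪ Fin N,
          ‖rowDiff Z (u 0) (u 1) (c 0) * rowDiff Z (u 0) (u 1) (c 1) *
            rowDiff Z (u 0) (u 2) (c 2)‖) ^ 2)
  else 0

/-- Embeddings `c : Fin 4 ↪ Fin n` and `u : Fin 4 ↪ Fin N` are the quadruples `(q, r, s, t)` of
distinct columns and `(u, v, w, x)` of distinct rows. -/
noncomputable def theta4 {N n : ℕ} (Z : Matrix (Fin N) (Fin n) ℂ) : ℝ :=
  if 4 ≤ n then
    ((N - 4).factorial / N.factorial : ℝ) * √((n - 4).factorial / n.factorial : ℝ) *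
      √(∑ c : Fin 4 ↪ Fin n,
        (∑ u : Fin 4 ↪ Fin N,
          ‖rowDiff Z (u 0) (u 1) (c 0) * rowDiff Z (u 0) (u 1) (c 1) *
            rowDiff Z (u 2) (u 3) (c 2) * rowDiff Z (u 2) (u 3) (c 3)‖) ^ 2)
  else 0

/-- The supremum is over the finite set of pairs `(J, R)` of a set of `ν` rows and a set of `ν`
columns, which is nonempty if `ν ≤ n ≤ N`; then it is a maximum. -/
noncomputable def kappa {N n : ℕ} (Z : Matrix (Fin N) (Fin n) ℂ) (ν : ℕ) : ℝ :=
  if ν + 1 ≤ n then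
    (1 / (((n : ℝ) - ν) * ((N : ℝ) - ν))) *
      ⨆ q : { q : Finset (Fin N) × Finset (Fin n) // q.1.card = ν ∧ q.2.card = ν },
        ∑ j ∈ q.1.1ᶜ, ∑ r ∈ q.1.2ᶜ, ‖Z j r‖ ^ 2
  else 1

/-- `f_n(x, y) = ∑_{k=3}^n (n+k-2)(n-k+1) x^{n-k} y^{k-3}`. -/
def fPoly (n : ℕ) (x y : ℝ) : ℝ :=
  ∑ k ∈ Icc 3 n, ((n : ℝ) + k - 2) * ((n : ℝ) - k + 1) * x ^ (n - k) * y ^ (k - 3)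

/-- `g_n(x, y) = ∑_{k=4}^n (k-3)(n+k-2)(n-k+1) x^{n-k} y^{k-4}`. -/
def gPoly (n : ℕ) (x y : ℝ) : ℝ :=
  ∑ k ∈ Icc 4 n,
    ((k : ℝ) - 3) * ((n : ℝ) + k - 2) * ((n : ℝ) - k + 1) * x ^ (n - k) * y ^ (k - 4)

end PermApprox

/-! Place the columns in `n` positions by a uniform permutation `τ`, and the rows by a uniform
permutation `σ`. For a set `Q` of positions, average the product that has the entry `z (σ (ι i)) (τ
i)` for `i ∈ Q` and the column mean elsewhere (`mixExpect`). For `Q = univ` this is the normalised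
permanent, for `Q = ∅` the product of the means, so positions are made random one at a time.

The increment contains `z (σ (ι s)) (τ s)` minus its mean, which is an average of row differences. A
difference with a position that the other factors do not see vanishes under a swap. A difference
with `t ∈ Q` antisymmetrises to minus half a product of two row differences
(`mixExpect_insert_sub`). These pair terms are telescoped down to `Q = ∅` in turn. Their values at
`∅` give exactly the second order term (`pairExpect_empty`). Each new increment meets one of the two
positions already used, giving the triple products of `theta3`, or a position of `Q`, giving the
quadruple products of `theta4` (`norm_pairExpect_insert_sub_le`).

The remaining factors are bounded in `norm_expect_mul_prod_mix_le`. Random entries are handled by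
the Carlen–Lieb–Loss inequality, a consequence of Banach's theorem on symmetric multilinear forms
and Maclaurin's inequality. Cauchy–Schwarz and Maclaurin over `τ` then produce the powers of `kappa`
and `beta`. -/

namespace PermApprox

open Finset Equiv
open scoped BigOperators

/-! ### Exchange identities for random permutations, and Maclaurin's inequality -/

section Exchange

variable {K α : Type*} [RCLike K] [Fintype α] [DecidableEq α]

/-- Reindexing an average over permutations by right multiplication. -/
theorem expect_perm_mul_right (f : Perm α → K) (ρ : Perm α) : 𝔼 σ, f (σ * ρ) = 𝔼 σ, f σ :=
  Fintype.expect_equiv (Equiv.mulRight ρ) _ _ fun _ => rfl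

/-- The average of `g (σ s)` against a function of `σ` which only depends on the values of `σ` on
`T`. -/
theorem expect_perm_sub_mean_mul [Nonempty α] (g : α → K) (F : Perm α → K) {s : α} {T : Finset α}
    (hF : ∀ p ∉ T, ∀ σ, F (σ * swap s p) = F σ) :
    𝔼 σ : Perm α, (g (σ s) - 𝔼 j, g j) * F σ =
      (1 / (Fintype.card α : K)) * ∑ t ∈ T, 𝔼 σ : Perm α, (g (σ s) - g (σ t)) * F σ := by
  have hN : (Fintype.card α : K) ≠ 0 := Nat.cast_ne_zero.2 Fintype.card_ne_zero
  have h1 : (Fintype.card α : K) * 𝔼 j, g j = ∑ j, g j := Fintype.card_mul_expect g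
  -- `N` times the deviation from the mean is the sum over all `p` of `g (σ s) - g (σ p)`; for `p ∉
  -- T` the swap of `s` and `p` fixes `F` and flips the sign.
  have h2 : ∀ p ∉ T, 𝔼 σ : Perm α, (g (σ s) - g (σ p)) * F σ = 0 := by
    intro p hp
    have : 𝔼 σ : Perm α, g (σ p) * F σ = 𝔼 σ : Perm α, g (σ s) * F σ := by
      rw [← expect_perm_mul_right (fun σ => g (σ s) * F σ) (swap s p)]
      refine expect_congr rfl fun σ _ => ?_
      simp [hF p hp σ]
    simp only [sub_mul, expect_sub_distrib, this, sub_self]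
  have h3 : ∑ t ∈ T, 𝔼 σ : Perm α, (g (σ s) - g (σ t)) * F σ =
      ∑ p, 𝔼 σ : Perm α, (g (σ s) - g (σ p)) * F σ :=
    sum_subset (subset_univ T) fun p _ hp => h2 p hp
  rw [h3, ← expect_sum_comm, mul_expect]
  refine expect_congr rfl fun σ _ => ?_
  rw [← sum_mul, sum_sub_distrib, sum_const, Equiv.sum_comp σ g, ← h1, nsmul_eq_mul, card_univ]
  field_simp

/-- Antisymmetrisation in two positions. -/
theorem expect_perm_antisymm (g h : α → K) (R : Perm α → K) {s t : α}
    (hR : ∀ σ, R (σ * swap s t) = R σ) :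
    𝔼 σ : Perm α, (g (σ s) - g (σ t)) * (h (σ t) * R σ) =
      -(1 / 2) * 𝔼 σ : Perm α, (g (σ s) - g (σ t)) * (h (σ s) - h (σ t)) * R σ := by
  have h1 : 𝔼 σ : Perm α, (g (σ s) - g (σ t)) * (h (σ t) * R σ) =
      𝔼 σ : Perm α, (g (σ t) - g (σ s)) * (h (σ s) * R σ) := by
    rw [← expect_perm_mul_right _ (swap s t)]
    refine expect_congr rfl fun σ _ => ?_
    simp [hR σ]
  have h2 : 𝔼 σ : Perm α, (g (σ s) - g (σ t)) * (h (σ s) - h (σ t)) * R σ =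
      -(𝔼 σ : Perm α, (g (σ t) - g (σ s)) * (h (σ s) * R σ)) -
        𝔼 σ : Perm α, (g (σ s) - g (σ t)) * (h (σ t) * R σ) := by
    rw [← expect_neg_distrib, ← expect_sub_distrib]
    exact expect_congr rfl fun σ _ => by ring
  rw [h2, ← h1]
  ring

/-- A form of Maclaurin's inequality: sampling without replacement. -/
theorem expect_perm_prod_le_pow (x : α → ℝ) (hx : ∀ j, 0 ≤ x j) (T : Finset α) :
    𝔼 σ : Perm α, ∏ i ∈ T, x (σ i) ≤ (𝔼 j, x j) ^ #T := by
  induction T using Finset.induction_on with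
  | empty => simp
  | insert s T hs ih =>
    have : Nonempty α := ⟨s⟩
    have hinv : ∀ p ∉ T, ∀ σ : Perm α,
        ∏ i ∈ T, x ((σ * swap s p) i) = ∏ i ∈ T, x (σ i) := by
      intro p hp σ
      refine prod_congr rfl fun i hi => ?_
      rw [Perm.mul_apply, swap_apply_of_ne_of_ne (ne_of_mem_of_not_mem hi hs)
        (ne_of_mem_of_not_mem hi hp)]
    have h1 := expect_perm_sub_mean_mul x (fun σ => ∏ i ∈ T, x (σ i)) hinv
    -- Negative correlation: antisymmetrised, each summand is `-1/2` times the mean of a square with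
    -- a nonnegative weight.
    have h2 : ∑ t ∈ T, 𝔼 σ : Perm α, (x (σ s) - x (σ t)) * ∏ i ∈ T, x (σ i) ≤ 0 := by
      refine sum_nonpos fun t ht => ?_
      have h3 := expect_perm_antisymm x x (fun σ => ∏ i ∈ T.erase t, x (σ i)) (s := s) (t := t)
        (by
          intro σ
          refine prod_congr rfl fun i hi => ?_
          rw [mem_erase] at hi
          rw [Perm.mul_apply, swap_apply_of_ne_of_ne (ne_of_mem_of_not_mem hi.2 hs) hi.1])
      have h4 : ∀ σ : Perm α, x (σ t) * ∏ i ∈ T.erase t, x (σ i) = ∏ i ∈ T, x (σ i) :=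
        fun σ => mul_prod_erase T (fun i => x (σ i)) ht
      simp only [h4] at h3
      rw [h3]
      have : 0 ≤ 𝔼 σ : Perm α, (x (σ s) - x (σ t)) * (x (σ s) - x (σ t)) *
          ∏ i ∈ T.erase t, x (σ i) :=
        expect_nonneg fun σ _ => mul_nonneg (mul_self_nonneg _) (prod_nonneg fun i _ => hx _)
      linarith
    have h4 : 𝔼 σ : Perm α, (x (σ s) - 𝔼 j, x j) * ∏ i ∈ T, x (σ i) ≤ 0 := by
      rw [h1]
      exact mul_nonpos_of_nonneg_of_nonpos (by positivity) h2
    simp only [sub_mul, expect_sub_distrib, ← mul_expect] at h4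
    simp only [prod_insert hs, card_insert_of_notMem hs]
    rw [pow_succ']
    have := mul_le_mul_of_nonneg_left ih (expect_nonneg fun j (_ : j ∈ univ) => hx j)
    linarith

end Exchange

/-! ### Uniform images of uniform group elements -/

section Fibres

/-- Averaging a function that factors through a map with equal fibres. -/
theorem expect_eq_expect_of_fibres {G X : Type*} [Group G] [Fintype G] [Fintype X] [DecidableEq X]
    {K : Type*} [RCLike K] (q : G → X) (hq : Function.Surjective q)
    (hmul : ∀ g g' k : G, q g = q g' → q (k * g) = q (k * g')) (f : X → K) :
    𝔼 g, f (q g) = 𝔼 x, f x := by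
  have hcard : ∀ x y : X, #{g | q g = x} ≤ #{g | q g = y} := by
    intro x y
    obtain ⟨a, rfl⟩ := hq x
    obtain ⟨b, rfl⟩ := hq y
    -- Left translation by `b * a⁻¹` carries one fibre injectively into the other.
    refine card_le_card_of_injOn (fun g => b * a⁻¹ * g) (fun g hg => ?_)
      (fun g _ g' _ h => mul_left_cancel h)
    simp only [coe_filter, mem_univ, true_and, Set.mem_ofPred_eq] at hg ⊢
    rw [hmul g a _ hg, inv_mul_cancel_right]
  obtain ⟨c, hc⟩ : ∃ c, ∀ x : X, #{g | q g = x} = c :=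
    ⟨_, fun x => le_antisymm (hcard x (q 1)) (hcard (q 1) x)⟩
  have hsum : ∑ g, f (q g) = c * ∑ x, f x := by
    rw [← sum_fiberwise univ q, mul_sum]
    refine sum_congr rfl fun x _ => ?_
    rw [sum_congr rfl (g := fun _ => f x) (by simp +contextual), sum_const, hc, nsmul_eq_mul]
  have htot : Fintype.card G = c * Fintype.card X := by
    rw [← card_univ, card_eq_sum_card_fiberwise (f := q) (t := univ) (by simp)]
    simp [hc, mul_comm]
  have hG : Fintype.card G ≠ 0 := Fintype.card_ne_zero
  rw [Fintype.expect_eq_sum_div_card, Fintype.expect_eq_sum_div_card, hsum, htot]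
  have hc0 : (c : K) ≠ 0 := by
    rintro h
    rw [Nat.cast_eq_zero] at h
    simp [h] at htot
  rw [Nat.cast_mul, mul_div_mul_left _ _ hc0]

/-- A uniformly random permutation restricts to a uniformly random embedding. -/
theorem expect_perm_embedding {α κ K : Type*} [Fintype α] [DecidableEq α] [Fintype κ]
    [DecidableEq κ] [RCLike K] (e : κ ↪ α) (f : (κ ↪ α) → K) :
    𝔼 σ : Perm α, f (e.trans σ.toEmbedding) = 𝔼 u, f u := by
  refine expect_eq_expect_of_fibres (fun σ : Perm α => e.trans σ.toEmbedding) ?_ ?_ f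
  · intro u
    obtain ⟨σ, hσ⟩ := Perm.exists_extending_pair e u e.injective u.injective
    exact ⟨σ, by ext i; simpa using hσ i⟩
  · intro g g' k h
    ext i
    have := DFunLike.congr_fun h i
    simp at this ⊢
    exact this

end Fibres

/-! ### Banach's theorem and the Carlen–Lieb–Loss inequality -/

section Multilinear

variable {κ α : Type*} [Fintype κ] [DecidableEq κ] [Fintype α] [DecidableEq α]

/-- Families of nonnegative vectors of Euclidean length one. -/
def nonnegUnitFamilies (κ α : Type*) [Fintype α] : Set (κ → α → ℝ) :=
  {a | ∀ i, (∀ j, 0 ≤ a i j) ∧ ∑ j, a i j ^ 2 = 1}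

omit [Fintype κ] [DecidableEq κ] [DecidableEq α] in
theorem isCompact_nonnegUnitFamilies : IsCompact (nonnegUnitFamilies κ α) := by
  have hsub : nonnegUnitFamilies κ α ⊆
      Set.pi Set.univ fun _ : κ => Set.pi Set.univ fun _ : α => Set.Icc (0 : ℝ) 1 := by
    intro a ha i _ j _
    refine ⟨(ha i).1 j, ?_⟩
    have h := single_le_sum (fun j _ => sq_nonneg (a i j)) (mem_univ j)
    rw [(ha i).2] at h
    exact (sq_le_one_iff₀ ((ha i).1 j)).1 h
  refine IsCompact.of_isClosed_subset
    (isCompact_univ_pi fun _ => isCompact_univ_pi fun _ => isCompact_Icc) ?_ hsub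
  simp only [nonnegUnitFamilies, Set.ofPred_forall, Set.ofPred_and]
  refine isClosed_iInter fun i => (isClosed_iInter fun j => ?_).inter ?_
  · exact isClosed_le continuous_const (by fun_prop)
  · exact isClosed_eq (by fun_prop) continuous_const

omit [Fintype κ] [DecidableEq α] in
theorem update_mem_nonnegUnitFamilies {a : κ → α → ℝ} (ha : a ∈ nonnegUnitFamilies κ α) (s : κ)
    {v : α → ℝ} (hv : ∀ j, 0 ≤ v j) (hv1 : ∑ j, v j ^ 2 = 1) :
    Function.update a s v ∈ nonnegUnitFamilies κ α := by
  intro i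
  rcases eq_or_ne i s with rfl | hi
  · simpa using ⟨hv, hv1⟩
  · simpa [hi] using ha i

omit [Fintype κ] in
/-- At a maximiser, a nonnegative multilinear form is in each variable `M` times the inner product
with the corresponding vector. -/
theorem multilinear_update_eq_of_isMaxOn {f : MultilinearMap ℝ (fun _ : κ => α → ℝ) ℝ}
    (hf : ∀ a, (∀ i j, 0 ≤ a i j) → 0 ≤ f a) {a : κ → α → ℝ} (ha : a ∈ nonnegUnitFamilies κ α)
    (hmax : ∀ a' ∈ nonnegUnitFamilies κ α, f a' ≤ f a) (s : κ) (v : α → ℝ) :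
    f (Function.update a s v) = f a * ∑ j, a s j * v j := by
  set b : α → ℝ := fun j => f (Function.update a s (Pi.single j 1)) with hb
  have hlin : ∀ v, f (Function.update a s v) = ∑ j, v j * b j := by
    intro v
    have h := LinearMap.pi_apply_eq_sum_univ (f.toLinearMap a s) v
    simp only [MultilinearMap.toLinearMap_apply, smul_eq_mul] at h
    rw [h]
    refine sum_congr rfl fun j _ => ?_
    congr 3
    ext i
    simp [Pi.single_apply, eq_comm]
  have hb0 : ∀ j, 0 ≤ b j := by
    intro j
    refine hf _ fun i k => ?_
    rcases eq_or_ne i s with rfl | hi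
    · simp only [Function.update_self]
      exact (Pi.single_nonneg.2 zero_le_one : (0 : α → ℝ) ≤ Pi.single j 1) k
    · simpa [hi] using (ha i).1 k
  have hM : f a = ∑ j, a s j * b j := by
    rw [← hlin, Function.update_eq_self]
  have hM0 : 0 ≤ f a := hf a fun i => (ha i).1
  -- Maximality is tested against the normalised coefficient vector `b / B`, where the form takes
  -- the value `B`.
  have hle : ∑ j, b j ^ 2 ≤ f a ^ 2 := by
    set B := √(∑ j, b j ^ 2) with hB
    have hnn : 0 ≤ ∑ j, b j ^ 2 := sum_nonneg fun j _ => sq_nonneg _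
    have hBsq : B ^ 2 = ∑ j, b j ^ 2 := Real.sq_sqrt hnn
    have hB0 : 0 ≤ B := Real.sqrt_nonneg _
    rcases hB0.eq_or_lt with h0 | hpos
    · rw [← hBsq, ← h0, zero_pow two_ne_zero]; positivity
    · have hmem := update_mem_nonnegUnitFamilies ha s (v := fun j => b j / B)
        (fun j => div_nonneg (hb0 j) hB0)
        (by simp only [div_pow]; rw [← sum_div, ← hBsq, div_self (by positivity)])
      have h := hmax _ hmem
      rw [hlin] at h
      have h2 : ∑ j, b j / B * b j = B := by
        have : ∀ j, b j / B * b j = b j ^ 2 / B := fun j => by ring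
        simp only [this]
        rw [← sum_div, ← hBsq, sq, mul_div_assoc, div_self hpos.ne', mul_one]
      rw [h2] at h
      rw [← hBsq]
      gcongr
  -- Equality case of Cauchy–Schwarz: the inner product of `b` with the unit vector `a s` is `f a`,
  -- while `b` has length at most `f a`.
  have hzero : ∑ j, (b j - f a * a s j) ^ 2 = 0 := by
    refine le_antisymm ?_ (sum_nonneg fun j _ => sq_nonneg _)
    have : ∑ j, (b j - f a * a s j) ^ 2 =
        ∑ j, b j ^ 2 - 2 * f a * ∑ j, a s j * b j + f a ^ 2 * ∑ j, a s j ^ 2 := by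
      rw [mul_sum, mul_sum, ← sum_sub_distrib, ← sum_add_distrib]
      exact sum_congr rfl fun j _ => by ring
    rw [this, ← hM, (ha s).2]
    linarith
  have hbj : ∀ j, b j = f a * a s j := by
    intro j
    have := (sum_eq_zero_iff_of_nonneg fun j _ => sq_nonneg _).1 hzero j (mem_univ j)
    exact sub_eq_zero.1 (pow_eq_zero_iff two_ne_zero |>.1 this)
  rw [hlin, mul_sum]
  exact sum_congr rfl fun j _ => by rw [hbj]; ring

/-- Banach's theorem on symmetric multilinear forms, for forms with nonnegative coefficients: the
maximum over unit vectors is attained on the diagonal. -/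
theorem exists_le_diagonal [Nonempty κ] (f : MultilinearMap ℝ (fun _ : κ => α → ℝ) ℝ)
    (hcont : Continuous f) (hsymm : ∀ s t a, f (a ∘ swap s t) = f a)
    (hf : ∀ a, (∀ i j, 0 ≤ a i j) → 0 ≤ f a) {a₀ : κ → α → ℝ}
    (ha₀ : a₀ ∈ nonnegUnitFamilies κ α) :
    ∃ x : α → ℝ, (∀ j, 0 ≤ x j) ∧ ∑ j, x j ^ 2 = 1 ∧ f a₀ ≤ f fun _ => x := by
  obtain ⟨a₁, ha₁, hmax₁⟩ := isCompact_nonnegUnitFamilies.exists_isMaxOn ⟨a₀, ha₀⟩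
    hcont.continuousOn
  have hclosed : IsClosed {a | f a = f a₁} := isClosed_eq hcont continuous_const
  -- Among all maximisers, take one whose vectors have the longest sum. If two of them differed,
  -- replacing both by their normalised sum would keep the value of `f` and lengthen the total.
  obtain ⟨a, ⟨ha, hfa⟩, hSmax⟩ := (isCompact_nonnegUnitFamilies.inter_right hclosed).exists_isMaxOn
    ⟨a₁, ha₁, rfl⟩ (f := fun a : κ → α → ℝ => ∑ j, (∑ i, a i j) ^ 2)
    (Continuous.continuousOn (by fun_prop))
  have hfa' : f a = f a₁ := hfa
  have hmax : ∀ a' ∈ nonnegUnitFamilies κ α, f a' ≤ f a := fun a' ha' =>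
    (hmax₁ ha').trans hfa'.ge
  have hupd := multilinear_update_eq_of_isMaxOn hf ha hmax
  have hall : ∀ s t, a s = a t := by
    intro s t
    by_contra hne
    have hst : s ≠ t := fun h => hne (h ▸ rfl)
    set p : α → ℝ := a s + a t with hp
    have hp0 : ∀ j, 0 ≤ p j := fun j => add_nonneg ((ha s).1 j) ((ha t).1 j)
    have hfp : f (Function.update (Function.update a s p) t p) = f a * ∑ j, p j ^ 2 := by
      have h1 : f (Function.update (Function.update a s p) t (a s)) = f (Function.update a t p) := by
        rw [← hsymm s t]
        congr 1
        ext i j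
        rcases eq_or_ne i s with rfl | his
        · simp [hst]
        rcases eq_or_ne i t with rfl | hit
        · simp [hst]
        · simp [swap_apply_of_ne_of_ne his hit, his, hit]
      have h2 : Function.update (Function.update a s p) t (a t) = Function.update a s p := by
        rw [Function.update_comm hst, Function.update_eq_self]
      nth_rewrite 2 [hp]
      rw [f.map_update_add, h1, h2, hupd, hupd, ← mul_add, ← sum_add_distrib]
      congr 1
      refine sum_congr rfl fun j _ => ?_
      simp only [hp, Pi.add_apply]
      ring
    set P := ∑ j, p j ^ 2 with hP
    have hcross : 0 ≤ ∑ j, a s j * a t j :=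
      sum_nonneg fun j _ => mul_nonneg ((ha s).1 j) ((ha t).1 j)
    have hP2 : P = 2 + 2 * ∑ j, a s j * a t j := by
      have : P = ∑ j, a s j ^ 2 + ∑ j, a t j ^ 2 + 2 * ∑ j, a s j * a t j := by
        rw [mul_sum, ← sum_add_distrib, ← sum_add_distrib]
        exact sum_congr rfl fun j _ => by simp only [hp, Pi.add_apply]; ring
      rw [this, (ha s).2, (ha t).2]; norm_num
    have hdiff : 0 < ∑ j, (a s j - a t j) ^ 2 := by
      obtain ⟨j, hj⟩ := Function.ne_iff.1 hne
      exact sum_pos' (fun _ _ => sq_nonneg _)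
        ⟨j, mem_univ j, by have := sub_ne_zero.2 hj; positivity⟩
    have hP4 : P < 4 := by
      have : ∑ j, (a s j - a t j) ^ 2 =
          ∑ j, a s j ^ 2 + ∑ j, a t j ^ 2 - 2 * ∑ j, a s j * a t j := by
        rw [mul_sum, ← sum_add_distrib, ← sum_sub_distrib]
        exact sum_congr rfl fun j _ => by ring
      rw [(ha s).2, (ha t).2] at this
      linarith
    have hPpos : 0 < P := by linarith
    set l := (√P)⁻¹ with hl
    have hl0 : 0 < l := by positivity
    have hl2 : l ^ 2 * P = 1 := by
      rw [hl, inv_pow, Real.sq_sqrt hPpos.le, inv_mul_cancel₀ hPpos.ne']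
    -- Distinct unit vectors have a sum of length less than 2, so normalising both copies of `p`
    -- makes their joint contribution `2 * l * p` longer than `p`.
    have hl1 : 1 < 2 * l := by
      by_contra! h
      have : l ^ 2 ≤ 1 / 4 := by nlinarith
      nlinarith
    set a' := Function.update (Function.update a s (l • p)) t (l • p) with ha'
    have hz0 : ∀ j, 0 ≤ (l • p) j := fun j => mul_nonneg hl0.le (hp0 j)
    have hz1 : ∑ j, (l • p) j ^ 2 = 1 := by
      simp only [Pi.smul_apply, smul_eq_mul, mul_pow]
      rw [← mul_sum, hl2]
    have ha'mem : a' ∈ nonnegUnitFamilies κ α :=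
      update_mem_nonnegUnitFamilies (update_mem_nonnegUnitFamilies ha s hz0 hz1) t hz0 hz1
    have hfa'' : f a' = f a₁ := by
      rw [ha', f.map_update_smul, Function.update_comm hst, f.map_update_smul,
        Function.update_comm hst.symm, hfp, ← hfa', smul_eq_mul, smul_eq_mul]
      linear_combination f a * hl2
    have hS := hSmax ⟨ha'mem, hfa''⟩
    simp only [Set.mem_ofPred_eq] at hS
    set W : α → ℝ := fun j => ∑ i ∈ (univ.erase s).erase t, a i j with hW
    have hW0 : ∀ j, 0 ≤ W j := fun j => sum_nonneg fun i _ => (ha i).1 j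
    have htmem : t ∈ univ.erase s := by simp [hst.symm]
    have hsum : ∀ j, ∑ i, a i j = p j + W j := by
      intro j
      rw [← add_sum_erase univ _ (mem_univ s), ← add_sum_erase _ _ htmem]
      simp only [hp, hW, Pi.add_apply]; ring
    have hsum' : ∀ j, ∑ i, a' i j = 2 * l * p j + W j := by
      intro j
      rw [← add_sum_erase univ _ (mem_univ s), ← add_sum_erase _ _ htmem]
      have : ∑ i ∈ (univ.erase s).erase t, a' i j = W j := by
        refine sum_congr rfl fun i hi => ?_
        simp only [mem_erase] at hi
        simp [ha', hi.1, hi.2.1]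
      rw [this]
      simp [ha', hst]; ring
    simp only [hsum, hsum'] at hS
    have hexp : ∑ j, (2 * l * p j + W j) ^ 2 = ∑ j, (p j + W j) ^ 2 +
        ((2 * l) ^ 2 - 1) * P + 2 * (2 * l - 1) * ∑ j, p j * W j := by
      rw [hP, mul_sum, mul_sum, ← sum_add_distrib, ← sum_add_distrib]
      exact sum_congr rfl fun j _ => by ring
    have hpW : 0 ≤ ∑ j, p j * W j := sum_nonneg fun j _ => mul_nonneg (hp0 j) (hW0 j)
    have h1 : 0 < ((2 * l) ^ 2 - 1) * P := mul_pos (by nlinarith) hPpos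
    have h2 : 0 ≤ 2 * (2 * l - 1) * ∑ j, p j * W j := mul_nonneg (by linarith) hpW
    linarith
  obtain ⟨i₀⟩ := ‹Nonempty κ›
  refine ⟨a i₀, (ha i₀).1, (ha i₀).2, (hmax a₀ ha₀).trans ?_⟩
  rw [show (fun _ => a i₀) = a from funext fun i => hall i₀ i]

/-- The permanent, averaged over all injections of the columns into the rows, as a multilinear
form in the columns. -/
noncomputable def permForm (e : κ ↪ α) : MultilinearMap ℝ (fun _ : κ => α → ℝ) ℝ :=
  (1 / ((Fintype.card (Perm α) : ℝ))) • ∑ σ : Perm α,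
    (MultilinearMap.mkPiAlgebra ℝ κ ℝ).compLinearMap fun i => LinearMap.proj (σ (e i))

omit [DecidableEq κ] in
theorem permForm_apply (e : κ ↪ α) (a : κ → α → ℝ) :
    permForm e a = 𝔼 σ : Perm α, ∏ i, a i (σ (e i)) := by
  rw [Fintype.expect_eq_sum_div_card]
  simp [permForm, div_eq_inv_mul]

/-- Normalised Hadamard type inequality of Carlen, Lieb and Loss for permanents. -/
theorem expect_perm_prod_le_prod_sqrt (e : κ ↪ α) (a : κ → α → ℝ) (ha : ∀ i j, 0 ≤ a i j) :
    𝔼 σ : Perm α, ∏ i, a i (σ (e i)) ≤ ∏ i, √(𝔼 j, a i j ^ 2) := by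
  rcases isEmpty_or_nonempty κ with hκ | hκ
  · simp
  have : Nonempty α := hκ.map e
  set A : κ → ℝ := fun i => ∑ j, a i j ^ 2 with hA
  have hA0 : ∀ i, 0 ≤ A i := fun i => sum_nonneg fun j _ => sq_nonneg _
  -- A zero vector cannot be normalised, but then both sides vanish or the bound is trivial.
  by_cases hzero : ∃ i, A i = 0
  · obtain ⟨i, hi⟩ := hzero
    have hai : ∀ j, a i j = 0 := fun j => by
      have := (sum_eq_zero_iff_of_nonneg fun j _ => sq_nonneg _).1 hi j (mem_univ j)
      exact pow_eq_zero_iff two_ne_zero |>.1 this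
    have : 𝔼 σ : Perm α, ∏ i, a i (σ (e i)) = 0 :=
      expect_eq_zero fun σ _ => prod_eq_zero (mem_univ i) (hai _)
    rw [this]
    exact prod_nonneg fun i _ => Real.sqrt_nonneg _
  push Not at hzero
  have hApos : ∀ i, 0 < A i := fun i => (hA0 i).lt_of_ne' (hzero i)
  have hunit : (fun i => (√(A i))⁻¹ • a i) ∈ nonnegUnitFamilies κ α := by
    refine fun i => ⟨fun j => mul_nonneg (by positivity) (ha i j), ?_⟩
    simp only [Pi.smul_apply, smul_eq_mul, mul_pow, inv_pow, Real.sq_sqrt (hA0 i)]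
    rw [← mul_sum]
    exact inv_mul_cancel₀ (hzero i)
  obtain ⟨x, hx0, hx1, hle⟩ := exists_le_diagonal (permForm e)
    (by
      rw [funext (permForm_apply e)]
      simp only [Fintype.expect_eq_sum_div_card]
      fun_prop)
    (by
      intro s t a
      rw [permForm_apply, permForm_apply, ← expect_perm_mul_right _ (swap (e s) (e t))]
      refine expect_congr rfl fun σ _ => ?_
      rw [← Equiv.prod_comp (swap s t)]
      refine prod_congr rfl fun i _ => ?_
      simp only [Function.comp_apply, swap_apply_self, Perm.mul_apply]
      rw [e.injective.map_swap, swap_apply_self])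
    (fun a ha => by
      rw [permForm_apply]
      exact expect_nonneg fun σ _ => prod_nonneg fun i _ => ha i _)
    hunit
  rw [MultilinearMap.map_smul_univ] at hle
  simp only [permForm_apply, smul_eq_mul] at hle
  -- On the diagonal, Maclaurin leaves a power of the mean of `x`, which is at most its root mean
  -- square.
  have hdiag : 𝔼 σ : Perm α, ∏ i, x (σ (e i)) ≤ (√(1 / (Fintype.card α : ℝ))) ^ Fintype.card κ := by
    have h1 := expect_perm_prod_le_pow x hx0 (univ.map e)
    simp only [prod_map, card_map, card_univ] at h1
    refine h1.trans (pow_le_pow_left₀ (expect_nonneg fun j _ => hx0 j) (Real.le_sqrt_of_sq_le ?_) _)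
    have h2 := expect_mul_sq_le_sq_mul_sq univ x fun _ => 1
    simp only [mul_one, one_pow, Fintype.expect_const] at h2
    refine h2.trans_eq ?_
    rw [Fintype.expect_eq_sum_div_card, hx1]
  have hfin := hle.trans hdiag
  rw [prod_inv_distrib, inv_mul_le_iff₀ (prod_pos fun i _ => Real.sqrt_pos.2 (hApos i))] at hfin
  refine hfin.trans_eq ?_
  rw [← card_univ (α := κ), ← prod_const, ← prod_mul_distrib]
  refine prod_congr rfl fun i _ => ?_
  rw [← Real.sqrt_mul (hA0 i), Fintype.expect_eq_sum_div_card, mul_one_div]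

end Multilinear

/-! ### Making one more position random -/

section Mixed

variable {α γ : Type*} [Fintype α] [DecidableEq α] [Fintype γ] [DecidableEq γ]

/-- The random entry of column `τ i` if `i ∈ Q`, and the mean of column `τ i` otherwise. -/
noncomputable def mix (z : α → γ → ℂ) (ι : γ ↪ α) (Q : Finset γ) (σ : Perm α) (τ : Perm γ)
    (i : γ) : ℂ :=
  if i ∈ Q then z (σ (ι i)) (τ i) else 𝔼 j, z j (τ i)

omit [Fintype γ] in
theorem prod_mix_mul_swap (z : α → γ → ℂ) (ι : γ ↪ α) {Q D : Finset γ} (σ : Perm α) (τ : Perm γ)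
    {a b : α} (ha : ∀ i ∈ D, i ∈ Q → ι i ≠ a) (hb : ∀ i ∈ D, i ∈ Q → ι i ≠ b) :
    ∏ i ∈ D, mix z ι Q (σ * swap a b) τ i = ∏ i ∈ D, mix z ι Q σ τ i := by
  refine prod_congr rfl fun i hi => ?_
  unfold mix
  split_ifs with hQ
  · rw [Perm.mul_apply, swap_apply_of_ne_of_ne (ha i hi hQ) (hb i hi hQ)]
  · rfl

/-- The effect of replacing the mean by the random entry in one further position. -/
theorem expect_mix_insert_sub (z : α → γ → ℂ) (ι : γ ↪ α) (τ : Perm γ) (W : Perm α → ℂ)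
    {C Q : Finset γ} (hW : ∀ a b, a ∉ C.map ι → b ∉ C.map ι → ∀ σ, W (σ * swap a b) = W σ)
    (hQ : Disjoint Q C) {s : γ} (hsC : s ∉ C) (hsQ : s ∉ Q) :
    𝔼 σ, W σ * ∏ i ∈ Cᶜ, mix z ι (insert s Q) σ τ i - 𝔼 σ, W σ * ∏ i ∈ Cᶜ, mix z ι Q σ τ i =
      (1 / (Fintype.card α : ℂ)) *
        (∑ t ∈ C, 𝔼 σ : Perm α, (z (σ (ι s)) (τ s) - z (σ (ι t)) (τ s)) *
            (W σ * ∏ i ∈ (insert s C)ᶜ, mix z ι Q σ τ i) -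
          1 / 2 * ∑ t ∈ Q, 𝔼 σ : Perm α, (z (σ (ι s)) (τ s) - z (σ (ι t)) (τ s)) *
            (z (σ (ι s)) (τ t) - z (σ (ι t)) (τ t)) *
            (W σ * ∏ i ∈ (insert t (insert s C))ᶜ, mix z ι Q σ τ i)) := by
  have : Nonempty α := ⟨ι s⟩
  set F : Perm α → ℂ := fun σ => W σ * ∏ i ∈ (insert s C)ᶜ, mix z ι Q σ τ i with hF
  have hsplit : Cᶜ = insert s (insert s C)ᶜ := by
    ext i
    by_cases h : i = s <;> simp [h, hsC]
  have hs' : s ∉ (insert s C)ᶜ := by simp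
  have h1 : 𝔼 σ, W σ * ∏ i ∈ Cᶜ, mix z ι (insert s Q) σ τ i -
      𝔼 σ, W σ * ∏ i ∈ Cᶜ, mix z ι Q σ τ i =
      𝔼 σ : Perm α, (z (σ (ι s)) (τ s) - 𝔼 j, z j (τ s)) * F σ := by
    rw [← expect_sub_distrib]
    refine expect_congr rfl fun σ _ => ?_
    rw [hsplit, prod_insert hs', prod_insert hs']
    have h2 : ∏ i ∈ (insert s C)ᶜ, mix z ι (insert s Q) σ τ i =
        ∏ i ∈ (insert s C)ᶜ, mix z ι Q σ τ i := by
      refine prod_congr rfl fun i hi => ?_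
      have : i ≠ s := fun h => hs' (h ▸ hi)
      simp [mix, this]
    rw [h2]
    simp only [hF, mix, hsQ, mem_insert_self, if_true, if_false]
    ring
  -- `W` sees only the positions of `C`, the mixed product only those of `Q`; hence only differences
  -- with `C ∪ Q` survive.
  have hFinv : ∀ p ∉ (C ∪ Q).map ι, ∀ σ, F (σ * swap (ι s) p) = F σ := by
    intro p hp σ
    rw [map_union, mem_union, not_or] at hp
    simp only [hF]
    rw [hW _ _ (by simpa using hsC) hp.1, prod_mix_mul_swap]
    · intro i _ hi h
      exact hsQ (ι.injective h ▸ hi)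
    · intro i _ hi h
      exact hp.2 (h ▸ mem_map_of_mem ι hi)
  rw [h1, expect_perm_sub_mean_mul (fun j => z j (τ s)) F hFinv, sum_map,
    sum_union hQ.symm, mul_sum _ _ (1 / 2), sub_eq_add_neg, ← sum_neg_distrib]
  congr 2
  refine sum_congr rfl fun t ht => ?_
  have htC : t ∉ C := disjoint_left.1 hQ ht
  have hts : t ≠ s := fun h => hsQ (h ▸ ht)
  -- For `t ∈ Q` the product contains the random entry at `t`, which antisymmetrisation turns into a
  -- second row difference.
  have h3 := expect_perm_antisymm (fun j => z j (τ s)) (fun j => z j (τ t))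
    (fun σ => W σ * ∏ i ∈ (insert t (insert s C))ᶜ, mix z ι Q σ τ i) (s := ι s) (t := ι t) (by
      intro σ
      rw [hW _ _ (by simpa using hsC) (by simpa using htC), prod_mix_mul_swap]
      · intro i hi _ h
        rw [ι.injective h] at hi
        simp at hi
      · intro i hi _ h
        rw [ι.injective h] at hi
        simp at hi)
  have hsplit' : (insert s C)ᶜ = insert t (insert t (insert s C))ᶜ := by
    ext i
    by_cases h : i = t <;> simp [h, htC, hts]
  rw [← neg_mul, ← h3]
  refine expect_congr rfl fun σ _ => ?_
  simp only [hF]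
  rw [hsplit', prod_insert (by simp)]
  simp only [mix, ht, if_true]
  ring

end Mixed

/-! ### Bounding the remaining factors -/

section Bound

variable {α γ : Type*} [Fintype α] [DecidableEq α] [Fintype γ] [DecidableEq γ]

/-- Averaging over a permutation and a further permutation of a subset. -/
theorem expect_perm_eq_expect_expect_ofSubtype {K : Type*} [RCLike K] (D : Finset α)
    (h : Perm α → K) :
    𝔼 σ, h σ = 𝔼 σ, 𝔼 ρ : Perm {p // p ∉ D}, h (σ * Perm.ofSubtype ρ) := by
  rw [expect_comm]
  simp only [expect_perm_mul_right, Fintype.expect_const]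

omit [Fintype α] in
theorem prod_ofSubtype {M : Type*} [CommMonoid M] {D Q : Finset α} (hQ : Disjoint Q D)
    (f : α → α → M) (ρ : Perm {p // p ∉ D}) :
    ∏ i ∈ Q, f i (Perm.ofSubtype ρ i) = ∏ i ∈ Q.subtype (· ∉ D), f i (ρ i) := by
  rw [← prod_subtype_of_mem (p := (· ∉ D)) _ fun i hi => disjoint_left.1 hQ hi]
  simp

/-- The mean of `‖z (σ p) r‖ ^ 2` over the positions outside `D`. -/
noncomputable def meanSqOutside (z : α → γ → ℂ) (D : Finset α) (σ : Perm α) (r : γ) : ℝ :=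
  𝔼 p : {p // p ∉ D}, ‖z (σ p) r‖ ^ 2

omit [Fintype γ] [DecidableEq γ] in
theorem meanSqOutside_nonneg (z : α → γ → ℂ) (D : Finset α) (σ : Perm α) (r : γ) :
    0 ≤ meanSqOutside z D σ r :=
  expect_nonneg fun _ _ => sq_nonneg _

omit [Fintype γ] in
-- Conditionally on the rows in the positions of `C`, the remaining rows are uniformly permuted, so
-- the Carlen–Lieb–Loss inequality applies with `A` constant.
theorem expect_rows_le (z : α → γ → ℂ) (ι : γ ↪ α) (τ : Perm γ) {C Q : Finset γ}
    (hQ : Disjoint Q C) {A : Perm α → ℝ} (hA0 : ∀ σ, 0 ≤ A σ)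
    (hA : ∀ σ (ρ : Perm {p // p ∉ C.map ι}), A (σ * Perm.ofSubtype ρ) = A σ) :
    𝔼 σ, A σ * ∏ i ∈ Q, ‖z (σ (ι i)) (τ i)‖ ≤
      𝔼 σ, A σ * ∏ i ∈ Q, √(meanSqOutside z (C.map ι) σ (τ i)) := by
  rw [expect_perm_eq_expect_expect_ofSubtype (C.map ι)]
  refine expect_le_expect fun σ _ => ?_
  simp only [hA, ← mul_expect]
  refine mul_le_mul_of_nonneg_left ?_ (hA0 σ)
  have hmem : ∀ i : Q, ι i ∉ C.map ι := fun i => by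
    simpa using disjoint_left.1 hQ i.2
  let e : Q ↪ {p // p ∉ C.map ι} :=
    ⟨fun i => ⟨ι i, hmem i⟩, fun i j h => Subtype.ext (ι.injective (by simpa using h))⟩
  have h := expect_perm_prod_le_prod_sqrt e (fun i p => ‖z (σ p) (τ i)‖) fun _ _ => norm_nonneg _
  rw [← prod_coe_sort Q]
  refine le_of_eq_of_le (expect_congr rfl fun ρ _ => ?_) h
  rw [← prod_coe_sort Q]
  refine prod_congr rfl fun i _ => ?_
  rw [Perm.mul_apply, Perm.ofSubtype_apply_of_mem ρ (hmem i)]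
  rfl

/-- Maclaurin's inequality for a permutation of the complement of `C`. -/
theorem expect_ofSubtype_prod_le_pow (x : γ → ℝ) (hx : ∀ j, 0 ≤ x j) {C Q : Finset γ}
    (hQ : Disjoint Q C) :
    𝔼 ρ : Perm {p // p ∉ C}, ∏ i ∈ Q, x (Perm.ofSubtype ρ i) ≤
      (𝔼 p : {p // p ∉ C}, x p) ^ #Q := by
  have h := expect_perm_prod_le_pow (fun p : {p // p ∉ C} => x p) (fun _ => hx _)
    (Q.subtype (· ∉ C))
  have hcard : #(Q.subtype (· ∉ C)) = #Q := by
    rw [card_subtype, filter_true_of_mem fun i hi => disjoint_left.1 hQ hi]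
  rw [hcard] at h
  refine le_of_eq_of_le (expect_congr rfl fun ρ _ => ?_) h
  exact prod_ofSubtype hQ (fun _ j => x j) ρ

theorem expect_mul_le_sqrt_mul_sqrt {ι : Type*} [Fintype ι] (f g : ι → ℝ) :
    𝔼 i, f i * g i ≤ √(𝔼 i, f i ^ 2) * √(𝔼 i, g i ^ 2) := by
  rw [← Real.sqrt_mul (expect_nonneg fun _ _ => sq_nonneg _)]
  exact Real.le_sqrt_of_sq_le (expect_mul_sq_le_sq_mul_sq _ _ _)

/-- The rows outside `C` are averaged first, then the columns outside `C`; both averages leave `‖Φ‖`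
fixed. The bound `hk` is asked only for nonempty `Q`, since otherwise `k` enters with exponent zero.
-/
theorem norm_expect_mul_prod_mix_le (z : α → γ → ℂ) (ι : γ ↪ α) {C Q : Finset γ}
    (hQ : Disjoint Q C) (Φ : Perm α → Perm γ → ℂ)
    (hσ : ∀ σ τ (ρ : Perm {p // p ∉ C.map ι}), ‖Φ (σ * Perm.ofSubtype ρ) τ‖ = ‖Φ σ τ‖)
    (hτ : ∀ σ τ (ρ : Perm {p // p ∉ C}), ‖Φ σ (τ * Perm.ofSubtype ρ)‖ = ‖Φ σ τ‖)
    {k : ℝ}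
    (hk : Q.Nonempty → ∀ σ (τ : Perm γ),
      𝔼 p : {p // p ∉ C}, meanSqOutside z (C.map ι) σ (τ p) ≤ k) :
    ‖𝔼 τ, 𝔼 σ, Φ σ τ * ∏ i ∈ Cᶜ, mix z ι Q σ τ i‖ ≤
      √(𝔼 τ, (𝔼 σ, ‖Φ σ τ‖) ^ 2) * √k ^ #Q * √(𝔼 r, ‖𝔼 j, z j r‖ ^ 2) ^ (#(Cᶜ \ Q)) := by
  set m : γ → ℝ := fun r => ‖𝔼 j, z j r‖ with hm
  set V := meanSqOutside z (C.map ι) with hV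
  have hQC : Q ⊆ Cᶜ := fun i hi => mem_compl.2 (disjoint_left.1 hQ hi)
  have hQ' : Disjoint (Cᶜ \ Q) C := disjoint_left.2 fun i hi => mem_compl.1 (mem_sdiff.1 hi).1
  set B : Perm γ → ℝ := fun τ => 𝔼 ρ : Perm {p // p ∉ C},
    ∏ i ∈ Cᶜ \ Q, m (τ (Perm.ofSubtype ρ i)) ^ 2 with hB
  have hB0 : ∀ τ, 0 ≤ B τ := fun τ => expect_nonneg fun _ _ => prod_nonneg fun _ _ => sq_nonneg _
  have hprod : ∀ σ τ, ‖∏ i ∈ Cᶜ, mix z ι Q σ τ i‖ =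
      (∏ i ∈ Q, ‖z (σ (ι i)) (τ i)‖) * ∏ i ∈ Cᶜ \ Q, m (τ i) := by
    intro σ τ
    rw [norm_prod, ← prod_sdiff hQC, mul_comm]
    congr 1
    · exact prod_congr rfl fun i hi => by simp [mix, hi]
    · exact prod_congr rfl fun i hi => by simp [mix, (mem_sdiff.1 hi).2, hm]
  have h1 : ‖𝔼 τ, 𝔼 σ, Φ σ τ * ∏ i ∈ Cᶜ, mix z ι Q σ τ i‖ ≤
      𝔼 τ, 𝔼 σ, ‖Φ σ τ‖ * (∏ i ∈ Q, √(V σ (τ i))) * ∏ i ∈ Cᶜ \ Q, m (τ i) := by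
    refine (RCLike.norm_expect_le (K := ℂ)).trans (expect_le_expect fun τ _ => (RCLike.norm_expect_le (K := ℂ)).trans ?_)
    simp only [norm_mul, hprod, ← mul_assoc, ← expect_mul]
    refine mul_le_mul_of_nonneg_right ?_ (prod_nonneg fun _ _ => norm_nonneg _)
    exact expect_rows_le z ι τ hQ (fun _ => norm_nonneg _) fun σ ρ => by rw [hσ]
  -- Cauchy–Schwarz separates random positions from mean positions; Maclaurin over the columns
  -- outside `C` bounds the former by a power of `k`.
  have h2 : ∀ σ τ, 𝔼 ρ : Perm {p // p ∉ C}, (∏ i ∈ Q, √(V σ (τ (Perm.ofSubtype ρ i)))) *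
      ∏ i ∈ Cᶜ \ Q, m (τ (Perm.ofSubtype ρ i)) ≤ √k ^ #Q * √(B τ) := by
    intro σ τ
    refine (expect_mul_le_sqrt_mul_sqrt _ _).trans ?_
    simp only [← prod_pow, Real.sq_sqrt (meanSqOutside_nonneg _ _ _ _), hV]
    refine mul_le_mul_of_nonneg_right ?_ (Real.sqrt_nonneg _)
    have h3 := expect_ofSubtype_prod_le_pow (fun r => V σ (τ r))
      (fun _ => meanSqOutside_nonneg _ _ _ _) hQ
    rcases Q.eq_empty_or_nonempty with rfl | hne
    · simp
    · have h4 : 0 ≤ 𝔼 p : {p // p ∉ C}, V σ (τ p) :=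
        expect_nonneg fun _ _ => meanSqOutside_nonneg _ _ _ _
      refine Real.sqrt_le_left ?_ |>.2 ?_
      · positivity
      · rw [← pow_mul, mul_comm, pow_mul, Real.sq_sqrt (h4.trans (hk hne σ τ))]
        exact h3.trans (pow_le_pow_left₀ h4 (hk hne σ τ) _)
  have h5 : 𝔼 τ, 𝔼 σ, ‖Φ σ τ‖ * (∏ i ∈ Q, √(V σ (τ i))) * ∏ i ∈ Cᶜ \ Q, m (τ i) ≤
      𝔼 τ, 𝔼 σ, ‖Φ σ τ‖ * (√k ^ #Q * √(B τ)) := by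
    rw [expect_comm, expect_comm (f := fun τ σ => ‖Φ σ τ‖ * (√k ^ #Q * √(B τ)))]
    refine expect_le_expect fun σ _ => ?_
    rw [expect_perm_eq_expect_expect_ofSubtype C]
    refine expect_le_expect fun τ _ => ?_
    simp only [hτ, mul_assoc, ← mul_expect]
    exact mul_le_mul_of_nonneg_left (h2 σ τ) (norm_nonneg _)
  have h6 : 𝔼 τ, B τ ≤ (𝔼 r, m r ^ 2) ^ #(Cᶜ \ Q) := by
    have h7 := expect_perm_eq_expect_expect_ofSubtype C
      (fun τ : Perm γ => ∏ i ∈ Cᶜ \ Q, m (τ i) ^ 2)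
    simp only [Perm.mul_apply] at h7
    rw [← h7]
    exact expect_perm_prod_le_pow (fun r => m r ^ 2) (fun _ => sq_nonneg _) _
  refine h1.trans (h5.trans ?_)
  -- As `B` does not depend on `σ`, a second Cauchy–Schwarz in `τ` alone suffices; this is why the
  -- row sum is squared inside the column sum in `theta3` and `theta4`.
  have h8 : 𝔼 τ, 𝔼 σ, ‖Φ σ τ‖ * (√k ^ #Q * √(B τ)) = √k ^ #Q * 𝔼 τ, (𝔼 σ, ‖Φ σ τ‖) * √(B τ) := by
    rw [mul_expect]
    refine expect_congr rfl fun τ _ => ?_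
    rw [← expect_mul]
    ring
  rw [h8, mul_comm (√_) (√k ^ _), mul_assoc]
  refine mul_le_mul_of_nonneg_left ((expect_mul_le_sqrt_mul_sqrt _ _).trans ?_) (by positivity)
  refine mul_le_mul_of_nonneg_left ?_ (Real.sqrt_nonneg _)
  simp only [Real.sq_sqrt (hB0 _)]
  refine Real.sqrt_le_left (by positivity) |>.2 ?_
  rw [← pow_mul, mul_comm, pow_mul, Real.sq_sqrt (expect_nonneg fun _ _ => sq_nonneg _)]
  exact h6

end Bound

/-! ### Identifying the averages with `theta3`, `theta4`, `kappa` and `beta` -/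

section Constants

theorem embedding_trans_mul_ofSubtype {α κ : Type*} [DecidableEq α] [Fintype κ] (e : κ ↪ α)
    (σ : Perm α) (ρ : Perm {p // p ∉ univ.map e}) :
    e.trans (σ * Perm.ofSubtype ρ).toEmbedding = e.trans σ.toEmbedding := by
  ext i
  have : ¬ e i ∉ univ.map e := by simp
  simp only [Function.Embedding.trans_apply, Equiv.coe_toEmbedding, Perm.mul_apply,
    Perm.ofSubtype_apply_of_not_mem ρ this]

theorem inv_card_embedding {ν m : ℕ} (h : ν ≤ m) :
    ((Fintype.card (Fin ν ↪ Fin m) : ℝ))⁻¹ = (m - ν).factorial / m.factorial := by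
  rw [Fintype.card_embedding_eq, Fintype.card_fin, Fintype.card_fin,
    ← Nat.factorial_mul_descFactorial h, Nat.cast_mul, div_mul_cancel_left₀]
  exact_mod_cast (Nat.factorial_ne_zero _)

variable {N n : ℕ}

theorem sqrt_expect_sq_expect_embedding {ν : ℕ} (hnN : n ≤ N) (hν : ν ≤ n)
    (Y : (Fin ν ↪ Fin N) → (Fin ν ↪ Fin n) → ℝ) :
    √(𝔼 c, (𝔼 u, Y u c) ^ 2) =
      ((N - ν).factorial / N.factorial : ℝ) * √((n - ν).factorial / n.factorial : ℝ) *
        √(∑ c, (∑ u, Y u c) ^ 2) := by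
  have h1 : 𝔼 c, (𝔼 u, Y u c) ^ 2 = ((N - ν).factorial / N.factorial : ℝ) ^ 2 *
      ((n - ν).factorial / n.factorial : ℝ) * ∑ c, (∑ u, Y u c) ^ 2 := by
    simp only [Fintype.expect_eq_sum_div_card, div_eq_mul_inv _ ((Fintype.card _ : ℕ) : ℝ),
      inv_card_embedding hν, inv_card_embedding (hν.trans hnN), mul_pow]
    rw [← sum_mul]
    ring
  rw [h1, Real.sqrt_mul (by positivity), Real.sqrt_mul (by positivity),
    Real.sqrt_sq (by positivity)]

/-- The iterated mean runs over the rows and columns outside the images of `C` under `σ` and `τ`,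
one of the pairs `(J, R)` in the supremum. -/
theorem expect_meanSqOutside_le_kappa (hnN : n ≤ N) (Z : Matrix (Fin N) (Fin n) ℂ)
    {C : Finset (Fin n)} {ν : ℕ} (hC : #C = ν) (hν : ν + 1 ≤ n) (ι : Fin n ↪ Fin N)
    (σ : Perm (Fin N)) (τ : Perm (Fin n)) :
    𝔼 p : {p // p ∉ C}, meanSqOutside Z (C.map ι) σ (τ p) ≤ kappa Z ν := by
  have hcard : ∀ {m : ℕ} (D : Finset (Fin m)), #D = ν → ν ≤ m →
      (Fintype.card {p // p ∉ D} : ℝ) = m - ν := by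
    intro m D hD hm
    rw [Fintype.card_subtype_compl, Fintype.card_fin, Fintype.card_coe, hD, Nat.cast_sub hm]
  have hsum : ∀ {m : ℕ} (D : Finset (Fin m)) (ρ : Perm (Fin m)) (f : Fin m → ℝ),
      ∑ p : {p // p ∉ D}, f (ρ p) = ∑ j ∈ (D.map ρ.toEmbedding)ᶜ, f j := by
    intro m D ρ f
    rw [← sum_subtype Dᶜ (fun _ => mem_compl) fun p => f (ρ p)]
    refine sum_bij (fun i _ => ρ i) ?_ (fun _ _ _ _ h => ρ.injective h) ?_ fun _ _ => rfl
    · intro a ha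
      simpa using ha
    · intro b hb
      exact ⟨ρ.symm b, by simpa [Equiv.symm_apply_eq, eq_comm] using hb, by simp⟩
  have hD : #(C.map ι) = ν := by rw [card_map, hC]
  have hn0 : (0 : ℝ) < n - ν := by
    rw [sub_pos]; exact_mod_cast hν
  have hN0 : (0 : ℝ) < N - ν := by
    rw [sub_pos]; exact_mod_cast hν.trans hnN
  simp only [meanSqOutside, Fintype.expect_eq_sum_div_card, hcard C hC (by omega),
    hcard (C.map ι) hD (by omega)]
  rw [kappa, if_pos hν, ← sum_div, div_div, mul_comm ((N : ℝ) - ν), div_eq_inv_mul, one_div]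
  refine mul_le_mul_of_nonneg_left ?_ (by positivity)
  rw [sum_comm, hsum (C.map ι) σ fun j => ∑ p : {p // p ∉ C}, ‖Z j (τ p)‖ ^ 2]
  simp only [fun j => hsum C τ fun r => ‖Z j r‖ ^ 2]
  exact le_ciSup (f := fun q : { q : Finset (Fin N) × Finset (Fin n) // #q.1 = ν ∧ #q.2 = ν } =>
    ∑ j ∈ q.1.1ᶜ, ∑ r ∈ q.1.2ᶜ, ‖Z j r‖ ^ 2) (Set.finite_range _).bddAbove
    ⟨((C.map ι).map σ.toEmbedding, C.map τ.toEmbedding), by simpa using hD, by simpa using hC⟩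

theorem colMean_eq_expect (Z : Matrix (Fin N) (Fin n) ℂ) (r : Fin n) :
    colMean Z r = 𝔼 j, Z j r := by
  rw [colMean, Fintype.expect_eq_sum_div_card, Fintype.card_fin, one_div, inv_mul_eq_div]

theorem beta_eq_expect (Z : Matrix (Fin N) (Fin n) ℂ) :
    beta Z = 𝔼 r, ‖𝔼 j, Z j r‖ ^ 2 := by
  simp only [beta, Fintype.expect_eq_sum_div_card (K := ℝ), Fintype.card_fin, colMean_eq_expect]
  rw [one_div, inv_mul_eq_div]

theorem norm_expect_embedding_mul_prod_mix_le (hnN : n ≤ N) (Z : Matrix (Fin N) (Fin n) ℂ)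
    (ι : Fin n ↪ Fin N) {ν : ℕ} (e : Fin ν ↪ Fin n) {Q : Finset (Fin n)}
    (hQ : Disjoint Q (univ.map e)) (Y : (Fin ν ↪ Fin N) → (Fin ν ↪ Fin n) → ℝ)
    (Φ : Perm (Fin N) → Perm (Fin n) → ℂ)
    (hΦ : ∀ σ τ, ‖Φ σ τ‖ = Y ((e.trans ι).trans σ.toEmbedding) (e.trans τ.toEmbedding)) :
    ‖𝔼 τ, 𝔼 σ, Φ σ τ * ∏ i ∈ (univ.map e)ᶜ, mix Z ι Q σ τ i‖ ≤
      ((N - ν).factorial / N.factorial : ℝ) * √((n - ν).factorial / n.factorial : ℝ) *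
        √(∑ c, (∑ u, Y u c) ^ 2) * √(kappa Z ν) ^ #Q * √(beta Z) ^ (n - ν - #Q) := by
  have hν : ν ≤ n := by simpa using Fintype.card_le_of_embedding e
  have hcard : #(univ.map e) = ν := by simp
  have hQC : Q ⊆ (univ.map e)ᶜ := fun i hi => mem_compl.2 (disjoint_left.1 hQ hi)
  have hmap : (univ.map e).map ι = univ.map (e.trans ι) := by rw [map_map]
  have h := norm_expect_mul_prod_mix_le Z ι hQ Φ
    (by
      rw [hmap]
      intro σ τ ρ
      rw [hΦ, hΦ, embedding_trans_mul_ofSubtype])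
    (by
      intro σ τ ρ
      rw [hΦ, hΦ, embedding_trans_mul_ofSubtype])
    (k := kappa Z ν)
    (by
      -- A point of `Q` outside the range of `e` forces `ν + 1 ≤ n`, so the default value of `kappa`
      -- plays no role.
      rintro ⟨i, hi⟩ σ τ
      refine expect_meanSqOutside_le_kappa hnN Z hcard ?_ ι σ τ
      have := card_le_univ (insert i (univ.map e))
      rwa [card_insert_of_notMem (disjoint_left.1 hQ hi), hcard, Fintype.card_fin] at this)
  refine h.trans_eq ?_
  rw [← beta_eq_expect, card_sdiff_of_subset hQC, card_compl, Fintype.card_fin, hcard,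
    ← sqrt_expect_sq_expect_embedding hnN hν]
  have h2 : 𝔼 τ, (𝔼 σ, ‖Φ σ τ‖) ^ 2 = 𝔼 c, (𝔼 u, Y u c) ^ 2 := by
    simp only [hΦ]
    rw [← expect_perm_embedding e]
    refine expect_congr rfl fun τ _ => ?_
    rw [expect_perm_embedding (e.trans ι) fun u => Y u (e.trans τ.toEmbedding)]
  rw [h2]

end Constants

/-! ### The two telescoping sums -/

section Telescope

variable {N n : ℕ}

/-- The averaged product with random entries in the positions of `Q` and column means elsewhere. -/
noncomputable def mixExpect (Z : Matrix (Fin N) (Fin n) ℂ) (ι : Fin n ↪ Fin N)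
    (Q : Finset (Fin n)) : ℂ :=
  𝔼 τ : Perm (Fin n), 𝔼 σ : Perm (Fin N), ∏ i, mix Z ι Q σ τ i

/-- As `mixExpect`, with a product of two row differences in the positions `s` and `t`. -/
noncomputable def pairExpect (Z : Matrix (Fin N) (Fin n) ℂ) (ι : Fin n ↪ Fin N) (s t : Fin n)
    (Q : Finset (Fin n)) : ℂ :=
  𝔼 τ : Perm (Fin n), 𝔼 σ : Perm (Fin N),
    rowDiff Z (σ (ι s)) (σ (ι t)) (τ s) * rowDiff Z (σ (ι s)) (σ (ι t)) (τ t) *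
      ∏ i ∈ ({t, s} : Finset (Fin n))ᶜ, mix Z ι Q σ τ i

theorem mix_erase (Z : Matrix (Fin N) (Fin n) ℂ) (ι : Fin n ↪ Fin N) {Q : Finset (Fin n)}
    {t i : Fin n} (h : i ≠ t) (σ : Perm (Fin N)) (τ : Perm (Fin n)) :
    mix Z ι (Q.erase t) σ τ i = mix Z ι Q σ τ i := by
  simp [mix, h]

theorem mixExpect_insert_sub (Z : Matrix (Fin N) (Fin n) ℂ) (ι : Fin n ↪ Fin N)
    {Q : Finset (Fin n)} {s : Fin n} (hs : s ∉ Q) :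
    mixExpect Z ι (insert s Q) - mixExpect Z ι Q =
      -(1 / (2 * (N : ℂ))) * ∑ t ∈ Q, pairExpect Z ι s t (Q.erase t) := by
  have h1 : ∀ τ : Perm (Fin n), 𝔼 σ, ∏ i, mix Z ι (insert s Q) σ τ i - 𝔼 σ, ∏ i, mix Z ι Q σ τ i =
      -(1 / (2 * (N : ℂ))) * ∑ t ∈ Q, 𝔼 σ : Perm (Fin N),
        rowDiff Z (σ (ι s)) (σ (ι t)) (τ s) * rowDiff Z (σ (ι s)) (σ (ι t)) (τ t) *
          ∏ i ∈ ({t, s} : Finset (Fin n))ᶜ, mix Z ι (Q.erase t) σ τ i := by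
    intro τ
    have h := expect_mix_insert_sub (Z : Fin N → Fin n → ℂ) ι τ (fun _ => 1) (C := ∅)
      (fun _ _ _ _ _ => rfl) (disjoint_empty_right Q) (notMem_empty s) hs
    simp only [compl_empty, one_mul, sum_empty, zero_sub, insert_empty_eq, Fintype.card_fin] at h
    rw [h, mul_neg, ← mul_assoc, ← neg_mul]
    congr 1
    · ring
    · refine sum_congr rfl fun t _ => expect_congr rfl fun σ _ => ?_
      congr 1
      refine prod_congr rfl fun i hi => (mix_erase Z ι ?_ σ τ).symm
      rintro rfl
      simp at hi
  simp only [mixExpect, pairExpect]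
  rw [← expect_sub_distrib, ← expect_sum_comm, mul_expect]
  exact expect_congr rfl fun τ _ => h1 τ

theorem norm_expect_triple_le (hnN : n ≤ N) (Z : Matrix (Fin N) (Fin n) ℂ) (ι : Fin n ↪ Fin N)
    {a b r : Fin n} (hab : a ≠ b) (har : a ≠ r) (hbr : b ≠ r) {Q : Finset (Fin n)}
    (hQ : Disjoint Q {a, b, r}) (Φ : Perm (Fin N) → Perm (Fin n) → ℂ)
    (hΦ : ∀ σ τ, ‖Φ σ τ‖ = ‖rowDiff Z (σ (ι a)) (σ (ι b)) (τ a) *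
      rowDiff Z (σ (ι a)) (σ (ι b)) (τ b) * rowDiff Z (σ (ι a)) (σ (ι r)) (τ r)‖) :
    ‖𝔼 τ, 𝔼 σ, Φ σ τ * ∏ i ∈ ({a, b, r} : Finset (Fin n))ᶜ, mix Z ι Q σ τ i‖ ≤
      theta3 Z * √(kappa Z 3) ^ #Q * √(beta Z) ^ (n - 3 - #Q) := by
  let e : Fin 3 ↪ Fin n := ⟨![a, b, r], by
    intro i j h
    fin_cases i <;> fin_cases j <;> simp_all⟩
  have he : univ.map e = {a, b, r} := by
    have hval : ∀ i, e i = ![a, b, r] i := fun _ => rfl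
    ext i
    simp [hval, Fin.exists_fin_succ, eq_comm]
  have hn : 3 ≤ n := by simpa using Fintype.card_le_of_embedding e
  rw [theta3, if_pos hn, ← he]
  rw [← he] at hQ
  exact norm_expect_embedding_mul_prod_mix_le hnN Z ι e hQ
    (fun u c => ‖rowDiff Z (u 0) (u 1) (c 0) * rowDiff Z (u 0) (u 1) (c 1) *
      rowDiff Z (u 0) (u 2) (c 2)‖) Φ hΦ

theorem norm_expect_quadruple_le (hnN : n ≤ N) (Z : Matrix (Fin N) (Fin n) ℂ) (ι : Fin n ↪ Fin N)
    {a b r q : Fin n} (hab : a ≠ b) (har : a ≠ r) (haq : a ≠ q) (hbr : b ≠ r) (hbq : b ≠ q)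
    (hrq : r ≠ q) {Q : Finset (Fin n)}
    (hQ : Disjoint Q {a, b, r, q}) (Φ : Perm (Fin N) → Perm (Fin n) → ℂ)
    (hΦ : ∀ σ τ, ‖Φ σ τ‖ = ‖rowDiff Z (σ (ι a)) (σ (ι b)) (τ a) *
      rowDiff Z (σ (ι a)) (σ (ι b)) (τ b) * rowDiff Z (σ (ι r)) (σ (ι q)) (τ r) *
      rowDiff Z (σ (ι r)) (σ (ι q)) (τ q)‖) :
    ‖𝔼 τ, 𝔼 σ, Φ σ τ * ∏ i ∈ ({a, b, r, q} : Finset (Fin n))ᶜ, mix Z ι Q σ τ i‖ ≤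
      theta4 Z * √(kappa Z 4) ^ #Q * √(beta Z) ^ (n - 4 - #Q) := by
  let e : Fin 4 ↪ Fin n := ⟨![a, b, r, q], by
    intro i j h
    fin_cases i <;> fin_cases j <;> simp_all⟩
  have he : univ.map e = {a, b, r, q} := by
    have hval : ∀ i, e i = ![a, b, r, q] i := fun _ => rfl
    ext i
    simp [hval, Fin.exists_fin_succ, eq_comm]
  have hn : 4 ≤ n := by simpa using Fintype.card_le_of_embedding e
  rw [theta4, if_pos hn, ← he]
  rw [← he] at hQ
  exact norm_expect_embedding_mul_prod_mix_le hnN Z ι e hQ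
    (fun u c => ‖rowDiff Z (u 0) (u 1) (c 0) * rowDiff Z (u 0) (u 1) (c 1) *
      rowDiff Z (u 2) (u 3) (c 2) * rowDiff Z (u 2) (u 3) (c 3)‖) Φ hΦ

/-- Bound for the change of `pairExpect` if the set of random positions, of cardinality `j`, grows
by one element. -/
noncomputable def stepBound (Z : Matrix (Fin N) (Fin n) ℂ) (j : ℕ) : ℝ :=
  (1 / (N : ℝ)) * (2 * (theta3 Z * √(kappa Z 3) ^ j * √(beta Z) ^ (n - 3 - j)) +
    1 / 2 * (j * (theta4 Z * √(kappa Z 4) ^ (j - 1) * √(beta Z) ^ (n - 3 - j))))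

/-- Making `r` random produces two differences of `r` with `s` or `t`, each bounded through
`theta3`, and `#Q` differences with positions of `Q`, each bounded through `theta4` with the factor
`1/2` of antisymmetrisation. -/
theorem norm_pairExpect_insert_sub_le (hnN : n ≤ N) (Z : Matrix (Fin N) (Fin n) ℂ)
    (ι : Fin n ↪ Fin N) {Q : Finset (Fin n)} {s t r : Fin n} (hst : s ≠ t)
    (hs : s ∉ insert r Q) (ht : t ∉ insert r Q) (hr : r ∉ Q) :
    ‖pairExpect Z ι s t (insert r Q) - pairExpect Z ι s t Q‖ ≤ stepBound Z #Q := by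
  rw [mem_insert, not_or] at hs ht
  have hQ : Disjoint Q {t, s} := by
    rw [disjoint_insert_right, disjoint_singleton_right]
    exact ⟨ht.2, hs.2⟩
  have hQr : Disjoint Q {r, t, s} := by
    rw [disjoint_insert_right]
    exact ⟨hr, hQ⟩
  have hW : ∀ τ : Perm (Fin n), ∀ a b, a ∉ ({t, s} : Finset (Fin n)).map ι →
      b ∉ ({t, s} : Finset (Fin n)).map ι → ∀ σ : Perm (Fin N),
      rowDiff Z ((σ * swap a b) (ι s)) ((σ * swap a b) (ι t)) (τ s) *
        rowDiff Z ((σ * swap a b) (ι s)) ((σ * swap a b) (ι t)) (τ t) =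
      rowDiff Z (σ (ι s)) (σ (ι t)) (τ s) * rowDiff Z (σ (ι s)) (σ (ι t)) (τ t) := by
    intro τ a b ha hb σ
    simp only [map_insert, map_singleton, mem_insert, mem_singleton, not_or] at ha hb
    simp only [Perm.mul_apply]
    rw [swap_apply_of_ne_of_ne (Ne.symm ha.2) (Ne.symm hb.2),
      swap_apply_of_ne_of_ne (Ne.symm ha.1) (Ne.symm hb.1)]
  have h1 := fun τ : Perm (Fin n) => expect_mix_insert_sub (Z : Fin N → Fin n → ℂ) ι τ
    (fun σ => rowDiff Z (σ (ι s)) (σ (ι t)) (τ s) * rowDiff Z (σ (ι s)) (σ (ι t)) (τ t))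
    (hW τ) hQ (s := r) (by simp [Ne.symm hs.1, Ne.symm ht.1]) hr
  have h2 : pairExpect Z ι s t (insert r Q) - pairExpect Z ι s t Q = (1 / (N : ℂ)) *
      (∑ q ∈ {t, s}, 𝔼 τ : Perm (Fin n), 𝔼 σ : Perm (Fin N),
          (rowDiff Z (σ (ι r)) (σ (ι q)) (τ r) *
            (rowDiff Z (σ (ι s)) (σ (ι t)) (τ s) * rowDiff Z (σ (ι s)) (σ (ι t)) (τ t))) *
            ∏ i ∈ ({r, t, s} : Finset (Fin n))ᶜ, mix Z ι Q σ τ i -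
        1 / 2 * ∑ q ∈ Q, 𝔼 τ : Perm (Fin n), 𝔼 σ : Perm (Fin N),
          (rowDiff Z (σ (ι r)) (σ (ι q)) (τ r) * rowDiff Z (σ (ι r)) (σ (ι q)) (τ q) *
            (rowDiff Z (σ (ι s)) (σ (ι t)) (τ s) * rowDiff Z (σ (ι s)) (σ (ι t)) (τ t))) *
            ∏ i ∈ ({q, r, t, s} : Finset (Fin n))ᶜ, mix Z ι (Q.erase q) σ τ i) := by
    simp only [pairExpect]
    rw [← expect_sub_distrib, ← expect_sum_comm, ← expect_sum_comm, mul_expect _ _ (1 / 2),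
      ← expect_sub_distrib, mul_expect]
    refine expect_congr rfl fun τ _ => ?_
    rw [h1 τ, Fintype.card_fin]
    congr 2
    · refine sum_congr rfl fun q _ => expect_congr rfl fun σ _ => ?_
      rw [← mul_assoc]
      rfl
    · congr 1
      refine sum_congr rfl fun q _ => expect_congr rfl fun σ _ => ?_
      rw [← mul_assoc]
      congr 1
      refine prod_congr rfl fun i hi => (mix_erase Z ι ?_ σ τ).symm
      rintro rfl
      simp at hi
  have hrev : ∀ u v r, ‖rowDiff Z u v r‖ = ‖rowDiff Z v u r‖ := fun u v r => norm_sub_rev _ _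
  have h3 : ∀ q ∈ ({t, s} : Finset (Fin n)), ‖𝔼 τ : Perm (Fin n), 𝔼 σ : Perm (Fin N),
          (rowDiff Z (σ (ι r)) (σ (ι q)) (τ r) *
            (rowDiff Z (σ (ι s)) (σ (ι t)) (τ s) * rowDiff Z (σ (ι s)) (σ (ι t)) (τ t))) *
            ∏ i ∈ ({r, t, s} : Finset (Fin n))ᶜ, mix Z ι Q σ τ i‖ ≤
      theta3 Z * √(kappa Z 3) ^ #Q * √(beta Z) ^ (n - 3 - #Q) := by
    intro q hq
    rw [mem_insert, mem_singleton] at hq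
    rcases hq with rfl | rfl
    -- The position shared by both differences must play the part of `u` in `theta3`: here it is
    -- `t`, in the other case `s`.
    · have hset : ({r, q, s} : Finset (Fin n)) = {q, s, r} := by ext i; simp; tauto
      rw [hset] at hQr ⊢
      refine norm_expect_triple_le hnN Z ι hst.symm ht.1 hs.1 hQr _ fun σ τ => ?_
      simp only [norm_mul, hrev (σ (ι r)), hrev (σ (ι s))]
      ring
    · have hset : ({r, t, q} : Finset (Fin n)) = {q, t, r} := by ext i; simp; tauto
      rw [hset] at hQr ⊢
      refine norm_expect_triple_le hnN Z ι hst hs.1 ht.1 hQr _ fun σ τ => ?_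
      simp only [norm_mul, hrev (σ (ι r))]
      ring
  have h4 : ∀ q ∈ Q, ‖𝔼 τ : Perm (Fin n), 𝔼 σ : Perm (Fin N),
          (rowDiff Z (σ (ι r)) (σ (ι q)) (τ r) * rowDiff Z (σ (ι r)) (σ (ι q)) (τ q) *
            (rowDiff Z (σ (ι s)) (σ (ι t)) (τ s) * rowDiff Z (σ (ι s)) (σ (ι t)) (τ t))) *
            ∏ i ∈ ({q, r, t, s} : Finset (Fin n))ᶜ, mix Z ι (Q.erase q) σ τ i‖ ≤
      theta4 Z * √(kappa Z 4) ^ (#Q - 1) * √(beta Z) ^ (n - 3 - #Q) := by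
    intro q hq
    have hset : ({q, r, t, s} : Finset (Fin n)) = {s, t, r, q} := by ext i; simp; tauto
    have hdisj : Disjoint (Q.erase q) {q, r, t, s} := by
      rw [disjoint_insert_right]
      exact ⟨notMem_erase q Q, hQr.mono_left (erase_subset q Q)⟩
    have hne : ∀ {i}, i ∉ Q → i ≠ q := fun hi h => hi (h ▸ hq)
    have hcard := card_pos.2 ⟨q, hq⟩
    -- The truncated subtractions agree because `Q` contains `q`.
    have hexp : n - 3 - #Q = n - 4 - (#Q - 1) := by omega
    rw [hset] at hdisj ⊢
    rw [hexp, ← card_erase_of_mem hq]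
    refine norm_expect_quadruple_le hnN Z ι hst hs.1 (hne hs.2) ht.1 (hne ht.2) (hne hr) hdisj _
      fun σ τ => ?_
    simp only [norm_mul]
    ring
  rw [h2, norm_mul, stepBound, norm_div, norm_one, Complex.norm_natCast]
  refine mul_le_mul_of_nonneg_left ((norm_sub_le _ _).trans (add_le_add ?_ ?_)) (by positivity)
  · refine (norm_sum_le _ _).trans ((sum_le_card_nsmul _ _ _ h3).trans_eq ?_)
    rw [card_pair hst.symm, nsmul_eq_mul, Nat.cast_two]
  · rw [norm_mul, norm_div, norm_one, Complex.norm_two]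
    refine mul_le_mul_of_nonneg_left ?_ (by norm_num)
    refine (norm_sum_le _ _).trans ((sum_le_card_nsmul _ _ _ h4).trans_eq ?_)
    rw [nsmul_eq_mul]

theorem norm_pairExpect_sub_empty_le (hnN : n ≤ N) (Z : Matrix (Fin N) (Fin n) ℂ)
    (ι : Fin n ↪ Fin N) {s t : Fin n} (hst : s ≠ t) {Q : Finset (Fin n)} (hs : s ∉ Q)
    (ht : t ∉ Q) :
    ‖pairExpect Z ι s t Q - pairExpect Z ι s t ∅‖ ≤ ∑ j ∈ range #Q, stepBound Z j := by
  induction Q using Finset.induction_on with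
  | empty => simp
  | insert r Q hr ih =>
    rw [card_insert_of_notMem hr, sum_range_succ]
    have h1 := norm_pairExpect_insert_sub_le hnN Z ι hst hs ht hr
    have h2 := ih (fun h => hs (mem_insert_of_mem h)) fun h => ht (mem_insert_of_mem h)
    rw [← sub_add_sub_cancel _ (pairExpect Z ι s t Q), add_comm]
    exact (norm_add_le _ _).trans (add_le_add h2 h1)

/-- The step from `k` to `k + 1` random positions involves `k` pair terms. Replacing each by its
common value `G` at `∅` gives the main term and costs `k - 1` pair increments per term. -/
theorem norm_mixExpect_sub_empty_add_le (hnN : n ≤ N) (Z : Matrix (Fin N) (Fin n) ℂ)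
    (ι : Fin n ↪ Fin N) {G : ℂ} (hG : ∀ s t, s ≠ t → pairExpect Z ι s t ∅ = G)
    (Q : Finset (Fin n)) :
    ‖mixExpect Z ι Q - mixExpect Z ι ∅ + 1 / (2 * (N : ℂ)) * ((∑ k ∈ range #Q, (k : ℂ)) * G)‖ ≤
      1 / (2 * (N : ℝ)) * ∑ k ∈ range #Q, k * ∑ j ∈ range (k - 1), stepBound Z j := by
  induction Q using Finset.induction_on with
  | empty => simp
  | insert s Q hs ih =>
    have h1 : mixExpect Z ι (insert s Q) - mixExpect Z ι ∅ +
        1 / (2 * (N : ℂ)) * ((∑ k ∈ range #(insert s Q), (k : ℂ)) * G) =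
        (mixExpect Z ι Q - mixExpect Z ι ∅ + 1 / (2 * (N : ℂ)) * ((∑ k ∈ range #Q, (k : ℂ)) * G)) +
        -(1 / (2 * (N : ℂ))) * ∑ t ∈ Q, (pairExpect Z ι s t (Q.erase t) - G) := by
      rw [card_insert_of_notMem hs, sum_range_succ, sum_sub_distrib, sum_const, nsmul_eq_mul]
      linear_combination mixExpect_insert_sub Z ι hs
    have h2 : ‖-(1 / (2 * (N : ℂ))) * ∑ t ∈ Q, (pairExpect Z ι s t (Q.erase t) - G)‖ ≤
        1 / (2 * (N : ℝ)) * (#Q * ∑ j ∈ range (#Q - 1), stepBound Z j) := by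
      rw [norm_mul, norm_neg, norm_div, norm_one, norm_mul, Complex.norm_natCast, Complex.norm_two]
      refine mul_le_mul_of_nonneg_left ?_ (by positivity)
      refine (norm_sum_le _ _).trans
        ((sum_le_card_nsmul _ _ (∑ j ∈ range (#Q - 1), stepBound Z j) fun t ht => ?_).trans_eq
          (nsmul_eq_mul _ _))
      have hst : s ≠ t := fun h => hs (h ▸ ht)
      rw [← hG s t hst, ← card_erase_of_mem ht]
      exact norm_pairExpect_sub_empty_le hnN Z ι hst (fun h => hs (mem_of_mem_erase h))
        (notMem_erase t Q)
    rw [h1, card_insert_of_notMem hs, sum_range_succ, mul_add]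
    exact (norm_add_le _ _).trans (add_le_add ih h2)

end Telescope

/-! ### Evaluating the endpoints of the telescoping sums -/

section Evaluation

theorem expect_perm_apply {K α : Type*} [RCLike K] [Fintype α] [DecidableEq α] (a : α)
    (f : α → K) : 𝔼 σ : Perm α, f (σ a) = 𝔼 j, f j := by
  refine expect_eq_expect_of_fibres (fun σ : Perm α => σ a) (fun b => ⟨swap a b, by simp⟩) ?_ f
  intro g g' k h
  simp only [Perm.mul_apply]
  exact congrArg k h

/-- The covariance of two functions of a random permutation, in terms of differences. -/
theorem expect_perm_sub_mul_sub {N : ℕ} (hN : 2 ≤ N) (g h : Fin N → ℂ) {a b : Fin N}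
    (hab : a ≠ b) :
    𝔼 σ : Perm (Fin N), (g (σ a) - g (σ b)) * (h (σ a) - h (σ b)) =
      2 / ((N : ℂ) - 1) * ∑ j, (g j - 𝔼 i, g i) * (h j - 𝔼 i, h i) := by
  have : Nonempty (Fin N) := ⟨a⟩
  set dg : Fin N → ℂ := fun j => g j - 𝔼 i, g i with hdg
  set dh : Fin N → ℂ := fun j => h j - 𝔼 i, h i with hdh
  have hN0 : (N : ℂ) ≠ 0 := Nat.cast_ne_zero.2 (by omega)
  have hN1 : (N : ℂ) - 1 ≠ 0 := by
    rw [sub_ne_zero]; exact_mod_cast (by omega : N ≠ 1)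
  have hdiag : ∀ c : Fin N, 𝔼 σ : Perm (Fin N), dg (σ c) * dh (σ c) = (∑ j, dg j * dh j) / N := by
    intro c
    rw [expect_perm_apply c fun j => dg j * dh j, Fintype.expect_eq_sum_div_card, Fintype.card_fin]
  -- The exchange identity with `T = {d}` expresses the cross moment through itself and the diagonal
  -- moment; solving gives the factor `-1 / (N - 1)`.
  have hcross : ∀ c d : Fin N, c ≠ d → 𝔼 σ : Perm (Fin N), dg (σ c) * dh (σ d) =
      -(∑ j, dg j * dh j) / (N * ((N : ℂ) - 1)) := by
    intro c d hcd
    have h1 := expect_perm_sub_mean_mul g (fun σ : Perm (Fin N) => dh (σ d)) (s := c) (T := {d})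
      (by
        intro p hp σ
        rw [mem_singleton] at hp
        simp only [Perm.mul_apply]
        rw [swap_apply_of_ne_of_ne hcd.symm (Ne.symm hp)])
    have h2 : 𝔼 σ : Perm (Fin N), (g (σ c) - g (σ d)) * dh (σ d) =
        𝔼 σ : Perm (Fin N), dg (σ c) * dh (σ d) - 𝔼 σ : Perm (Fin N), dg (σ d) * dh (σ d) := by
      rw [← expect_sub_distrib]
      exact expect_congr rfl fun σ _ => by simp only [hdg]; ring
    rw [sum_singleton, h2, hdiag, Fintype.card_fin] at h1
    change 𝔼 σ : Perm (Fin N), dg (σ c) * dh (σ d) = _ at h1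
    generalize 𝔼 σ : Perm (Fin N), dg (σ c) * dh (σ d) = x at h1 ⊢
    field_simp at h1 ⊢
    linear_combination h1
  have hexp : 𝔼 σ : Perm (Fin N), (g (σ a) - g (σ b)) * (h (σ a) - h (σ b)) =
      (𝔼 σ : Perm (Fin N), dg (σ a) * dh (σ a) + 𝔼 σ : Perm (Fin N), dg (σ b) * dh (σ b)) -
      (𝔼 σ : Perm (Fin N), dg (σ a) * dh (σ b) + 𝔼 σ : Perm (Fin N), dg (σ b) * dh (σ a)) := by
    rw [← expect_add_distrib, ← expect_add_distrib, ← expect_sub_distrib]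
    exact expect_congr rfl fun σ _ => by simp only [hdg, hdh]; ring
  rw [hexp, hdiag, hdiag, hcross a b hab, hcross b a hab.symm]
  field_simp
  ring

variable {N n : ℕ}

theorem expect_perm_map_pair {s t : Fin n} (hst : s ≠ t) (f : Finset (Fin n) → ℂ) :
    𝔼 τ : Perm (Fin n), f (({t, s} : Finset (Fin n)).map τ.toEmbedding) =
      2 / ((n : ℂ) * ((n : ℂ) - 1)) * ∑ R ∈ univ.powersetCard 2, f R := by
  have hpair : #({t, s} : Finset (Fin n)) = 2 := card_pair hst.symm
  have h := expect_eq_expect_of_fibres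
    (fun τ : Perm (Fin n) => (⟨({t, s} : Finset (Fin n)).map τ.toEmbedding, by
      rw [mem_powersetCard, card_map]; exact ⟨subset_univ _, hpair⟩⟩ : (univ : Finset (Fin n)).powersetCard 2))
    (by
      rintro ⟨R, hR⟩
      obtain ⟨τ, hτ⟩ := Perm.exists_map_finset_eq {t, s} R
        (by rw [hpair, (mem_powersetCard.1 hR).2])
      exact ⟨τ, Subtype.ext hτ⟩)
    (by
      intro g g' k hg
      have hg' := congrArg Subtype.val hg
      refine Subtype.ext ?_
      have hmul : ∀ g : Perm (Fin n), (k * g).toEmbedding = g.toEmbedding.trans k.toEmbedding :=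
        fun _ => rfl
      simp only [hmul, ← map_map] at hg' ⊢
      rw [hg'])
    (fun R => f R)
  rw [h, Fintype.expect_eq_sum_div_card, Fintype.card_coe, card_powersetCard, card_univ,
    Fintype.card_fin, Nat.cast_choose_two, sum_coe_sort _ f, div_div_eq_mul_div]
  ring

/-- The row average is a covariance with factor `2 / (N - 1)`; the column average makes the image of
`{s, t}` a uniform pair, with factor `2 / (n * (n - 1))`. Hence the value is the same for all `s ≠
t`. -/
theorem pairExpect_empty (hn : 2 ≤ n) (hnN : n ≤ N) (Z : Matrix (Fin N) (Fin n) ℂ)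
    (ι : Fin n ↪ Fin N) {s t : Fin n} (hst : s ≠ t) :
    pairExpect Z ι s t ∅ =
      4 / ((n : ℂ) * ((n : ℂ) - 1) * ((N : ℂ) - 1)) * secondOrderTerm Z := by
  have h1 : pairExpect Z ι s t ∅ = 𝔼 τ : Perm (Fin n), 2 / ((N : ℂ) - 1) *
      (fun R : Finset (Fin n) => (∏ r ∈ Rᶜ, colMean Z r) * ∑ j, ∏ r ∈ R, (Z j r - colMean Z r))
        (({t, s} : Finset (Fin n)).map τ.toEmbedding) := by
    refine expect_congr rfl fun τ _ => ?_
    have hprod : ∏ r ∈ (({t, s} : Finset (Fin n)).map τ.toEmbedding)ᶜ, colMean Z r =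
        ∏ i ∈ ({t, s} : Finset (Fin n))ᶜ, 𝔼 j, Z j (τ i) := by
      have : (({t, s} : Finset (Fin n)).map τ.toEmbedding)ᶜ =
          ({t, s} : Finset (Fin n))ᶜ.map τ.toEmbedding := by
        ext i
        simp only [mem_compl, mem_map_equiv]
      rw [this, prod_map]
      exact prod_congr rfl fun i _ => colMean_eq_expect Z _
    have hmix : ∀ σ i, mix Z ι ∅ σ τ i = 𝔼 j, Z j (τ i) := fun σ i => by simp [mix]
    simp only [hmix, ← expect_mul]
    rw [hprod]
    have h2 := expect_perm_sub_mul_sub (hn.trans hnN) (fun j => Z j (τ s)) (fun j => Z j (τ t))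
      (ι.injective.ne hst)
    simp only [rowDiff]
    rw [h2]
    simp only [prod_map, prod_pair hst.symm, Equiv.coe_toEmbedding, colMean_eq_expect]
    rw [sum_congr rfl fun j _ => mul_comm (Z j (τ s) - _) _]
    ring
  rw [h1, ← mul_expect, expect_perm_map_pair hst
    (fun R => (∏ r ∈ Rᶜ, colMean Z r) * ∑ j, ∏ r ∈ R, (Z j r - colMean Z r)),
    secondOrderTerm, ← mul_assoc]
  congr 1
  rw [div_mul_div_comm]
  congr 1 <;> ring

theorem mixExpect_empty (Z : Matrix (Fin N) (Fin n) ℂ) (ι : Fin n ↪ Fin N) :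
    mixExpect Z ι ∅ = ∏ r, colMean Z r := by
  have h : ∀ (τ : Perm (Fin n)) (σ : Perm (Fin N)), ∏ i, mix Z ι ∅ σ τ i = ∏ r, colMean Z r := by
    intro τ σ
    rw [← Equiv.prod_comp τ (colMean Z)]
    exact prod_congr rfl fun i _ => by simp [mix, colMean_eq_expect]
  simp only [mixExpect, h, Fintype.expect_const]

theorem mixExpect_univ (hnN : n ≤ N) (Z : Matrix (Fin N) (Fin n) ℂ) (ι : Fin n ↪ Fin N) :
    mixExpect Z ι univ = ((N - n).factorial / N.factorial : ℂ) * rectPermanent Z := by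
  have h : ∀ τ : Perm (Fin n), 𝔼 σ : Perm (Fin N), ∏ i, mix Z ι univ σ τ i =
      ((N - n).factorial / N.factorial : ℂ) * rectPermanent Z := by
    intro τ
    have h1 := expect_perm_embedding ι fun u => ∏ i, Z (u i) (τ i)
    simp only [mix, mem_univ, if_true]
    refine h1.trans ?_
    have h2 : ∑ u : Fin n ↪ Fin N, ∏ i, Z (u i) (τ i) = rectPermanent Z := by
      -- Relabelling the positions by `τ` permutes the injections, so the column permutation is
      -- immaterial here.
      refine Fintype.sum_equiv (Equiv.embeddingCongr τ (Equiv.refl _)) _ _ fun u => ?_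
      rw [← Equiv.prod_comp τ fun r => Z (_ : Fin N) r]
      simp [Equiv.embeddingCongr]
    have h3 := inv_card_embedding hnN
    have h4 : ((Fintype.card (Fin n ↪ Fin N) : ℂ))⁻¹ = (N - n).factorial / N.factorial := by
      have h5 := congrArg (fun x : ℝ => (x : ℂ)) h3
      push_cast at h5
      exact h5
    rw [Fintype.expect_eq_sum_div_card, h2, div_eq_inv_mul, h4]
  simp only [mixExpect, h, Fintype.expect_const]

end Evaluation

/-! ### Summing the error bounds -/

section Summation

/-- Exchanging the sums, `E j` receives `∑ k` over `j + 2 ≤ k ≤ n - 1`. Twice this is `(n + k - 2) *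
(n - k + 1)` at `k = j + 3`, the coefficient in `fPoly`. -/
theorem sum_range_mul_sum_range (E : ℕ → ℝ) (n : ℕ) :
    ∑ k ∈ range n, (k : ℝ) * ∑ j ∈ range (k - 1), E j =
      ∑ j ∈ range (n - 2), ((n : ℝ) * (n - 1) - (j + 2) * (j + 1)) / 2 * E j := by
  induction n with
  | zero => simp
  | succ n ih =>
    rw [sum_range_succ, ih]
    rcases n with _ | _ | n
    · simp
    · simp
    · simp only [show n + 1 + 1 - 1 = n + 1 by omega,
        show n + 1 + 1 + 1 - 2 = n + 1 by omega, show n + 1 + 1 - 2 = n by omega]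
      rw [mul_sum, sum_range_succ, sum_range_succ _ n, ← add_assoc, ← sum_add_distrib]
      congr 1
      · refine sum_congr rfl fun j _ => ?_
        push_cast
        ring
      · push_cast
        ring

theorem fPoly_eq_sum_range (n : ℕ) (hn : 2 ≤ n) (x y : ℝ) :
    fPoly n x y =
      ∑ j ∈ range (n - 2), ((n : ℝ) * (n - 1) - (j + 2) * (j + 1)) * (x ^ (n - 3 - j) * y ^ j) := by
  rw [fPoly, ← Finset.Ico_add_one_right_eq_Icc, sum_Ico_eq_sum_range,
    show n + 1 - 3 = n - 2 by omega]
  refine sum_congr rfl fun j _ => ?_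
  rw [show n - (3 + j) = n - 3 - j by omega, show 3 + j - 3 = j by omega]
  push_cast
  ring

theorem gPoly_eq_sum_range (n : ℕ) (hn : 2 ≤ n) (x y : ℝ) :
    gPoly n x y =
      ∑ j ∈ range (n - 2),
        ((n : ℝ) * (n - 1) - (j + 2) * (j + 1)) * (j * (x ^ (n - 3 - j) * y ^ (j - 1))) := by
  have h : gPoly n x y = ∑ k ∈ Icc 3 n, ((k : ℝ) - 3) * ((n : ℝ) + k - 2) * ((n : ℝ) - k + 1) *
      x ^ (n - k) * y ^ (k - 4) := by
    -- The added term `k = 3` vanishes through its factor `k - 3`, whatever the truncated exponent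
    -- `k - 4`.
    refine sum_subset (Icc_subset_Icc_left (by norm_num)) fun k hk hk' => ?_
    have : k = 3 := by
      simp only [mem_Icc] at hk hk'
      omega
    simp [this]
  rw [h, ← Finset.Ico_add_one_right_eq_Icc, sum_Ico_eq_sum_range,
    show n + 1 - 3 = n - 2 by omega]
  refine sum_congr rfl fun j _ => ?_
  rw [show n - (3 + j) = n - 3 - j by omega, show 3 + j - 4 = j - 1 by omega]
  push_cast
  ring

theorem sum_stepBound {N n : ℕ} (hn : 2 ≤ n) (Z : Matrix (Fin N) (Fin n) ℂ) :
    1 / (2 * (N : ℝ)) * ∑ k ∈ range n, (k : ℝ) * ∑ j ∈ range (k - 1), stepBound Z j =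
      theta3 Z / (2 * (N : ℝ) ^ 2) * fPoly n (√(beta Z)) (√(kappa Z 3)) +
        theta4 Z / (8 * (N : ℝ) ^ 2) * gPoly n (√(beta Z)) (√(kappa Z 4)) := by
  rw [sum_range_mul_sum_range, fPoly_eq_sum_range n hn, gPoly_eq_sum_range n hn, mul_sum, mul_sum,
    mul_sum, ← sum_add_distrib]
  refine sum_congr rfl fun j _ => ?_
  simp only [stepBound, div_eq_mul_inv, mul_inv, one_mul]
  ring

end Summation

end PermApprox

theorem mainTheorem5 (N n : ℕ) (hn : 2 ≤ n) (hnN : n ≤ N) (Z : Matrix (Fin N) (Fin n) ℂ) :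
    ‖((N - n).factorial / N.factorial : ℂ) * PermApprox.rectPermanent Z
        - ∏ r, PermApprox.colMean Z r
        + PermApprox.secondOrderTerm Z / ((N : ℂ) * ((N : ℂ) - 1))‖
      ≤ PermApprox.theta3 Z / (2 * (N : ℝ) ^ 2)
            * PermApprox.fPoly n (√(PermApprox.beta Z)) (√(PermApprox.kappa Z 3))
        + PermApprox.theta4 Z / (8 * (N : ℝ) ^ 2)
            * PermApprox.gPoly n (√(PermApprox.beta Z)) (√(PermApprox.kappa Z 4)) := by
  have h := PermApprox.norm_mixExpect_sub_empty_add_le hnN Z (Fin.castLEEmb hnN)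
    (fun s t hst => PermApprox.pairExpect_empty hn hnN Z _ hst) Finset.univ
  rw [PermApprox.mixExpect_univ hnN, PermApprox.mixExpect_empty, Finset.card_univ, Fintype.card_fin,
    PermApprox.sum_stepBound hn] at h
  refine le_of_eq_of_le ?_ h
  have hN0 : (N : ℂ) ≠ 0 := Nat.cast_ne_zero.2 (by omega)
  have hN1 : (N : ℂ) - 1 ≠ 0 := by
    rw [sub_ne_zero]; exact_mod_cast (by omega : N ≠ 1)
  have hn0 : (n : ℂ) ≠ 0 := Nat.cast_ne_zero.2 (by omega)
  have hn1 : (n : ℂ) - 1 ≠ 0 := by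
    rw [sub_ne_zero]; exact_mod_cast (by omega : n ≠ 1)
  have hgauss : 2 * ∑ k ∈ Finset.range n, (k : ℂ) = n * ((n : ℂ) - 1) := by
    have := Finset.sum_range_id_mul_two n
    rw [← Nat.cast_sum, mul_comm, ← Nat.cast_pred (by omega : 0 < n)]
    exact_mod_cast this
  have hsum : ∑ k ∈ Finset.range n, (k : ℂ) = n * ((n : ℂ) - 1) / 2 := by
    rw [← hgauss]; ring
  -- The main terms combine as `1 / (2N) * (n (n - 1) / 2) * 4 / (n (n - 1) (N - 1)) = 1 / (N (N -
  -- 1))`.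
  rw [hsum]
  congr 2
  field_simp
  norm_num
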